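/- Conventions. All manifolds are smooth, Hausdorff and second countable; all tensors are smooth. A Hermitian manifold $(M,J,g)$ of complex dimension $n\ge 2$ is a manifold with an integrable almost complex structure $J$ and a Riemannian metric $g$ with $g(J\cdot,J\cdot)=g$; its fundamental form is $\omega=g(J\cdot,\cdot)$. It is locally conformally Kähler (lcK) with Lee form $\theta$ if $\theta$ is a closed $1$-form with $d\omega=\theta\wedge\omega$; the Lee field is the vector field $T=\theta^\sharp$, i.e. $g(T,\cdot)=\theta$. It is Vaisman if moreover $\theta$ is parallel for the Levi-Civita connection of $g$. $J$ acts on $1$-forms by $J\alpha=-\alpha\circ J$, so that $J\theta=g(JT,\cdot)$. A vector field $X$ is holomorphic if $\mathcal L_XJ=0$. (1) Let $(M,J,g)$ be a Vaisman manifold of complex dimension $n\ge2$ whose Lee form $\theta$ satisfies $|\theta|=1$, and let $T=\theta^\sharp$. For a function $f$ on $M$, $df\wedge\theta=0$ if and only if the gradient of $f$ is everywhere a multiple of $T$. Let $f\in C^\infty(M)$ be non-constant with $f>-1$ and $df\wedge\theta=0$, and put $$\bar\omega=\omega+f\,\theta\wedge J\theta,\qquad \bar g=\bar\omega(\cdot,J\cdot).$$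 Then $\bar g$ is a Riemannian metric, $(M,J,\bar g)$ is lcK with fundamental form $\bar\omega$, with Lee form $\bar\theta=(1+f)\theta$, and with the same Lee field $\bar T=T$, which is holomorphic. Moreover $\bar g(\bar T,\bar T)=1+f$, so the norm of the Lee field of $\bar g$ is not constant; if $M$ is connected, then $(M,J,\bar g)$ is not Vaisman. (2) Let $n\ge 2$, $a>1$, and let $M$ be the Hopf manifold $(\mathbb C^n\setminus\{0\})/\langle x\mapsto ax\rangle$. Then $M$ is a compact connected manifold diffeomorphic to $S^1\times S^{2n-1}$. With $r=|x|$, the standard complex structure, the metric $4r^{-2}g_{\mathbb C^n}$ and the form $-2\,dr/r$ descend to a Vaisman structure $(J,g)$ on $M$ with Lee form $\theta$ of norm $1$. If $h\colon(0,\infty)\to\mathbb R$ is smooth and non-constant, with $|h|<1$ and $h(ar)=h(r)$ for all $r$, for instance $h(r)=\tfrac12\sin(2\pi\ln r/\ln a)$, then $h(r)$ descends to a function $f$ on $M$ that satisfies the hypotheses of (1), and $\bar g$ is an lcK metric on the compact manifold $M$ with Lee form $(1+f)\theta$ and holomorphic Lee field that is not Vaisman. -/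

import Mathlib

open scoped Manifold ContDiff Topology

universe u v

namespace LCK

open Bundle

noncomputable section

/-! ### Tensor fields on a smooth manifold modelled on a real normed space -/

section Forms

variable {E : Type*} [NormedAddCommGroup E] [NormedSpace ℝ E]
  {M : Type*} [TopologicalSpace M] [ChartedSpace E M]

variable (E M) in
/-- (Not necessarily smooth) vector fields. -/
abbrev VField := ∀ x : M, TangentSpace 𝓘(ℝ, E) x

variable (E M) in
/-- (Not necessarily smooth) `1`-forms. -/
abbrev Form1 := ∀ x : M, TangentSpace 𝓘(ℝ, E) x →L[ℝ] ℝ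

variable (E M) in
/-- (Not necessarily smooth) bilinear forms; `2`-forms are the alternating ones. -/
abbrev Form2 := ∀ x : M, TangentSpace 𝓘(ℝ, E) x →L[ℝ] TangentSpace 𝓘(ℝ, E) x →L[ℝ] ℝ

variable (E M) in
/-- (Not necessarily smooth) fields of endomorphisms of the tangent bundle. -/
abbrev EndField := ∀ x : M, TangentSpace 𝓘(ℝ, E) x →L[ℝ] TangentSpace 𝓘(ℝ, E) x

/-- The differential of a real function, as a `1`-form. -/
def diff (f : M → ℝ) : Form1 E M := fun x ↦ mvfderiv 𝓘(ℝ, E) f x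

/-- `α ∧ β` for `1`-forms: `(α ∧ β)(v, w) = α(v) β(w) - α(w) β(v)`. -/
def wedge (α β : Form1 E M) : Form2 E M :=
  fun x ↦ (α x).smulRight (β x) - (β x).smulRight (α x)

/-- `(α ∧ η)(u, v, w)` for a `1`-form `α` and a `2`-form `η`. -/
def wedge12 (α : Form1 E M) (η : Form2 E M) (x : M) (u v w : TangentSpace 𝓘(ℝ, E) x) : ℝ :=
  α x u * η x v w - α x v * η x u w + α x w * η x u v

/-- The vector field `X` is differentiable at the point `x`. -/
def DiffAt [IsManifold 𝓘(ℝ, E) 1 M] (X : VField E M) (x : M) : Prop :=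
  MDifferentiableAt 𝓘(ℝ, E) (𝓘(ℝ, E).prod 𝓘(ℝ, E))
    (fun y ↦ (TotalSpace.mk' E y (X y) : TangentBundle 𝓘(ℝ, E) M)) x

/-- The Lie bracket of vector fields. -/
def bracket (X Y : VField E M) : VField E M := VectorField.mlieBracket 𝓘(ℝ, E) X Y

/-- `dα(X, Y) = X(α(Y)) - Y(α(X)) - α([X, Y])` for a `1`-form `α`. -/
def extDeriv1 (α : Form1 E M) (X Y : VField E M) (x : M) : ℝ :=
  diff (fun y ↦ α y (Y y)) x (X x) - diff (fun y ↦ α y (X y)) x (Y x) - α x (bracket X Y x)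

/-- The exterior derivative of a `2`-form `η`:
`dη(X, Y, Z) = X(η(Y, Z)) - Y(η(X, Z)) + Z(η(X, Y)) - η([X, Y], Z) + η([X, Z], Y) - η([Y, Z], X)`.
-/
def extDeriv2 (η : Form2 E M) (X Y Z : VField E M) (x : M) : ℝ :=
  diff (fun y ↦ η y (Y y) (Z y)) x (X x) - diff (fun y ↦ η y (X y) (Z y)) x (Y x)
    + diff (fun y ↦ η y (X y) (Y y)) x (Z x)
    - η x (bracket X Y x) (Z x) + η x (bracket X Z x) (Y x) - η x (bracket Y Z x) (X x)

variable [IsManifold 𝓘(ℝ, E) ∞ M]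

/-- Smooth vector fields. -/
def SmoothVField (X : VField E M) : Prop :=
  ContMDiff 𝓘(ℝ, E) (𝓘(ℝ, E).prod 𝓘(ℝ, E)) ∞
    (fun x ↦ (TotalSpace.mk' E x (X x) : TangentBundle 𝓘(ℝ, E) M))

/-- Smooth `1`-forms, i.e. smooth sections of the cotangent bundle. -/
def SmoothForm1 (α : Form1 E M) : Prop :=
  ContMDiff 𝓘(ℝ, E) (𝓘(ℝ, E).prod 𝓘(ℝ, E →L[ℝ] ℝ)) ∞
    (fun x ↦ TotalSpace.mk' (E →L[ℝ] ℝ)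
      (E := fun x : M ↦ TangentSpace 𝓘(ℝ, E) x →L[ℝ] Bundle.Trivial M ℝ x) x (α x))

/-- A `1`-form `α` is closed: `dα = 0`. -/
def Closed1 (α : Form1 E M) : Prop :=
  ∀ (x : M) (X Y : VField E M), DiffAt X x → DiffAt Y x → extDeriv1 α X Y x = 0

variable (E M) in
/-- An integrable almost complex structure: a smooth field `J` of endomorphisms of the tangent
bundle with `J² = -1` and vanishing Nijenhuis tensor. -/
structure ComplexStructure where
  /-- The endomorphism field. -/
  toFun : EndField E M
  smooth : ContMDiff 𝓘(ℝ, E) (𝓘(ℝ, E).prod 𝓘(ℝ, E →L[ℝ] E)) ∞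
    (fun x ↦ TotalSpace.mk' (E →L[ℝ] E)
      (E := fun x : M ↦ TangentSpace 𝓘(ℝ, E) x →L[ℝ] TangentSpace 𝓘(ℝ, E) x) x (toFun x))
  sq : ∀ (x : M) (v : TangentSpace 𝓘(ℝ, E) x), toFun x (toFun x v) = -v
  nijenhuis : ∀ (x : M) (X Y : VField E M), DiffAt X x → DiffAt Y x →
    bracket (fun y ↦ toFun y (X y)) (fun y ↦ toFun y (Y y)) x
      - toFun x (bracket (fun y ↦ toFun y (X y)) Y x)
      - toFun x (bracket X (fun y ↦ toFun y (Y y)) x)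
      - bracket X Y x = 0

instance : CoeFun (ComplexStructure E M) (fun _ ↦ EndField E M) := ⟨ComplexStructure.toFun⟩

variable (E M) in
/-- Smooth Riemannian metrics on `M`. -/
abbrev RMetric := ContMDiffRiemannianMetric 𝓘(ℝ, E) ∞ E (fun x : M ↦ TangentSpace 𝓘(ℝ, E) x)

/-- The action of `J` on `1`-forms. It is the one that corresponds to `J` on vectors under the
metric duality of a Hermitian metric: if `α = g(A, ·)`, then `Jα = g(JA, ·)`. -/
def ComplexStructure.onForm (J : ComplexStructure E M) (α : Form1 E M) : Form1 E M :=
  fun x ↦ -(α x).comp (J x)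

/-- `X` is a (real) holomorphic vector field: smooth with `𝓛_X J = 0`, that is
`[X, JY] = J[X, Y]` for all `Y`. -/
def IsHolomorphic (J : ComplexStructure E M) (X : VField E M) : Prop :=
  SmoothVField X ∧ ∀ (x : M) (Y : VField E M), DiffAt Y x →
    bracket X (fun y ↦ J y (Y y)) x = J x (bracket X Y x)

/-- `g` is Hermitian with respect to `J`. -/
def IsHermitian (J : ComplexStructure E M) (g : RMetric E M) : Prop :=
  ∀ (x : M) (v w : TangentSpace 𝓘(ℝ, E) x), g.inner x (J x v) (J x w) = g.inner x v w

/-- The fundamental form `ω = g(J ·, ·)`. -/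
def fundamentalForm (J : ComplexStructure E M) (g : RMetric E M) : Form2 E M :=
  fun x ↦ (g.inner x).comp (J x)

/-- `(M, J, g)` is locally conformally Kähler with Lee form `θ`: `g` is Hermitian, `θ` is a smooth
closed `1`-form, and `dω = θ ∧ ω`. -/
structure IsLCKWith (J : ComplexStructure E M) (g : RMetric E M) (θ : Form1 E M) : Prop where
  hermitian : IsHermitian J g
  smooth : SmoothForm1 θ
  closed : Closed1 θ
  lee : ∀ (x : M) (X Y Z : VField E M), DiffAt X x → DiffAt Y x → DiffAt Z x →
    extDeriv2 (fundamentalForm J g) X Y Z x =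
      wedge12 θ (fundamentalForm J g) x (X x) (Y x) (Z x)

/-- A covariant derivative on the tangent bundle is the Levi-Civita connection of `g`: it is
torsion-free and metric. Here `D Y x v` is `(∇_v Y)(x)`. -/
structure IsLeviCivita (g : RMetric E M)
    (D : CovariantDerivative 𝓘(ℝ, E) E (fun x : M ↦ TangentSpace 𝓘(ℝ, E) x)) : Prop where
  torsion_free : ∀ (x : M) (X Y : VField E M), DiffAt X x → DiffAt Y x →
    D Y x (X x) - D X x (Y x) = bracket X Y x
  metric : ∀ (x : M) (v : TangentSpace 𝓘(ℝ, E) x) (Y Z : VField E M), DiffAt Y x → DiffAt Z x →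
    diff (fun y ↦ g.inner y (Y y) (Z y)) x v =
      g.inner x (D Y x v) (Z x) + g.inner x (Y x) (D Z x v)

/-- The `1`-form `α` is parallel with respect to the Levi-Civita connection of `g`:
`(∇_v α)(Y) = v(α(Y)) - α(∇_v Y) = 0`. -/
def IsParallel (g : RMetric E M) (α : Form1 E M) : Prop :=
  ∃ D : CovariantDerivative 𝓘(ℝ, E) E (fun x : M ↦ TangentSpace 𝓘(ℝ, E) x),
    IsLeviCivita g D ∧
      ∀ (x : M) (v : TangentSpace 𝓘(ℝ, E) x) (Y : VField E M), DiffAt Y x →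
        diff (fun y ↦ α y (Y y)) x v - α x (D Y x v) = 0

/-- `(M, J, g)` is Vaisman with Lee form `θ`. -/
def IsVaismanWith (J : ComplexStructure E M) (g : RMetric E M) (θ : Form1 E M) : Prop :=
  IsLCKWith J g θ ∧ IsParallel g θ

/-- `(M, J, g)` is Vaisman. -/
def IsVaisman (J : ComplexStructure E M) (g : RMetric E M) : Prop :=
  ∃ θ : Form1 E M, IsVaismanWith J g θ

theorem exists_sharp [FiniteDimensional ℝ E] (g : RMetric E M) (α : Form1 E M) (x : M) :
    ∃ v : TangentSpace 𝓘(ℝ, E) x, ∀ w, g.inner x v w = α x w := by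
  have : FiniteDimensional ℝ (TangentSpace 𝓘(ℝ, E) x) := inferInstanceAs (FiniteDimensional ℝ E)
  let L : TangentSpace 𝓘(ℝ, E) x →ₗ[ℝ] Module.Dual ℝ (TangentSpace 𝓘(ℝ, E) x) :=
    { toFun := fun v ↦ (g.inner x v).toLinearMap
      map_add' := fun v w ↦ by ext; simp
      map_smul' := fun c v ↦ by ext; simp }
  have hinj : Function.Injective L := by
    rw [injective_iff_map_eq_zero]
    intro v hv
    by_contra hne
    have h1 := g.pos x v hne
    have h2 : g.inner x v v = 0 := LinearMap.congr_fun hv v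
    exact absurd h2 h1.ne'
  have hsurj : Function.Surjective L :=
    (LinearMap.injective_iff_surjective_of_finrank_eq_finrank
      (Subspace.dual_finrank_eq (K := ℝ)).symm).1 hinj
  obtain ⟨v, hv⟩ := hsurj (α x).toLinearMap
  exact ⟨v, fun w ↦ LinearMap.congr_fun hv w⟩

/-- The vector field `α♯` that is metrically dual to the `1`-form `α`. -/
def sharp [FiniteDimensional ℝ E] (g : RMetric E M) (α : Form1 E M) : VField E M :=
  fun x ↦ Classical.choose (exists_sharp g α x)

theorem inner_sharp [FiniteDimensional ℝ E] (g : RMetric E M) (α : Form1 E M) (x : M)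
    (w : TangentSpace 𝓘(ℝ, E) x) : g.inner x (sharp g α x) w = α x w :=
  Classical.choose_spec (exists_sharp g α x) w

/-- The pointwise norm of a vector field. -/
def vnorm (g : RMetric E M) (X : VField E M) (x : M) : ℝ := √(g.inner x (X x) (X x))

/-- The pointwise norm of a `1`-form. -/
def fnorm [FiniteDimensional ℝ E] (g : RMetric E M) (α : Form1 E M) : M → ℝ := vnorm g (sharp g α)

/-- The deformed form `ω + f θ ∧ Jθ`. -/
def deformedForm (J : ComplexStructure E M) (g : RMetric E M) (θ : Form1 E M) (f : M → ℝ) :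
    Form2 E M :=
  fun x ↦ fundamentalForm J g x + f x • wedge θ (J.onForm θ) x

/-- `f` is a smooth non-constant function with `f > -1` and `df ∧ θ = 0`. -/
structure IsAdmissible (θ : Form1 E M) (f : M → ℝ) : Prop where
  smooth : ContMDiff 𝓘(ℝ, E) 𝓘(ℝ, ℝ) ∞ f
  nonconst : ¬ ∃ c : ℝ, ∀ x, f x = c
  gt_neg_one : ∀ x, -1 < f x
  wedge_eq_zero : ∀ x, wedge (diff f) θ x = 0

end Forms

/-! ### The Hopf manifold -/

section Hopf

/-- `ℂⁿ` with its Euclidean norm. -/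
abbrev Cn (n : ℕ) := EuclideanSpace ℂ (Fin n)

/-- `ℂⁿ \ {0}`. -/
def punctured (n : ℕ) : TopologicalSpace.Opens (Cn n) := ⟨{0}ᶜ, isOpen_compl_singleton⟩

/-- The infinite cyclic group of dilations `x ↦ aᵏ x`, `k ∈ ℤ`. -/
def Dilations (_a : ℝ) := Multiplicative ℤ

instance (a : ℝ) : CommGroup (Dilations a) := inferInstanceAs (CommGroup (Multiplicative ℤ))

/-- The exponent `k` of the dilation `x ↦ aᵏ x`. -/
def Dilations.exponent {a : ℝ} (k : Dilations a) : ℤ := Multiplicative.toAdd (k : Multiplicative ℤ)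

variable {n : ℕ} {a : ℝ} [ha : Fact (1 < a)]

theorem punctured_ne_zero (x : punctured n) : (x : Cn n) ≠ 0 := x.2

theorem dilation_pos (k : ℤ) : 0 < a ^ k := zpow_pos (zero_lt_one.trans ha.out) k

instance : MulAction (Dilations a) (punctured n) where
  smul k x := ⟨a ^ k.exponent • (x : Cn n),
    smul_ne_zero (dilation_pos k.exponent).ne' (punctured_ne_zero x)⟩
  one_smul x := Subtype.ext (by
    change a ^ (0 : ℤ) • (x : Cn n) = x
    simp)
  mul_smul k l x := Subtype.ext (by
    change a ^ (k.exponent + l.exponent) • (x : Cn n) = a ^ k.exponent • a ^ l.exponent • (x : Cn n)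
    rw [zpow_add₀ (zero_lt_one.trans ha.out).ne', mul_smul])

theorem coe_dilation_smul (k : Dilations a) (x : punctured n) :
    ((k • x : punctured n) : Cn n) = a ^ k.exponent • (x : Cn n) := rfl

instance : ContinuousConstSMul (Dilations a) (punctured n) where
  continuous_const_smul k :=
    (continuous_subtype_val.const_smul (a ^ k.exponent)).subtype_mk _

instance : IsCancelSMul (Dilations a) (punctured n) where
  left_cancel' k x y h := by
    have := congrArg (fun z ↦ k⁻¹ • z) h
    simpa using this
  right_cancel' k l x h := by
    have h1 : a ^ k.exponent • (x : Cn n) = a ^ l.exponent • (x : Cn n) := congrArg Subtype.val h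
    exact zpow_right_injective₀ (zero_lt_one.trans ha.out) ha.out.ne'
      (smul_left_injective ℝ (punctured_ne_zero x) h1)

instance : ProperlyDiscontinuousSMul (Dilations a) (punctured n) where
  finite_disjoint_inter_image {K L} hK hL := by
    have hlog : Continuous fun x : punctured n ↦ Real.log ‖(x : Cn n)‖ :=
      continuous_subtype_val.norm.log fun x ↦ norm_ne_zero_iff.2 (punctured_ne_zero x)
    obtain ⟨B, hB⟩ := (hK.image hlog).isBounded.exists_norm_le
    obtain ⟨C, hC⟩ := (hL.image hlog).isBounded.exists_norm_le
    have hla : 0 < Real.log a := Real.log_pos ha.out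
    have hfin : (Set.Icc (-⌈(B + C) / Real.log a⌉) ⌈(B + C) / Real.log a⌉ : Set ℤ).Finite :=
      Set.finite_Icc _ _
    have hfin' : {k : ℤ | |(k : ℝ)| ≤ (B + C) / Real.log a}.Finite := by
      refine hfin.subset fun k hk ↦ ?_
      have hk' := abs_le.1 (show |(k : ℝ)| ≤ (B + C) / Real.log a from hk)
      have hc := Int.le_ceil ((B + C) / Real.log a)
      constructor
      · exact_mod_cast (by push_cast; linarith : ((-⌈(B + C) / Real.log a⌉ : ℤ) : ℝ) ≤ k)
      · exact_mod_cast hk'.2.trans hc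
    refine Set.Finite.subset hfin' ?_
    · rintro (k : Dilations a) ⟨_, ⟨x, hx, rfl⟩, hy⟩
      have h1 : |Real.log ‖(x : Cn n)‖| ≤ B := hB _ ⟨x, hx, rfl⟩
      have h2 : |Real.log ‖((k • x : punctured n) : Cn n)‖| ≤ C := hC _ ⟨_, hy, rfl⟩
      rw [coe_dilation_smul, norm_smul, Real.norm_of_nonneg (dilation_pos _).le,
        Real.log_mul (dilation_pos _).ne' (norm_ne_zero_iff.2 (punctured_ne_zero x)),
        Real.log_zpow] at h2
      change |(k.exponent : ℝ)| ≤ _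
      rw [le_div_iff₀ hla]
      nth_rewrite 1 [← abs_of_pos hla]
      rw [← abs_mul]
      rw [abs_le] at *
      constructor <;> linarith [h1.1, h1.2, h2.1, h2.2]

instance : LocallyCompactSpace (punctured n) := (punctured n).isOpen.locallyCompactSpace

variable (n a) in
/-- The Hopf manifold `(ℂⁿ \ {0}) / ⟨x ↦ a x⟩`, with the quotient topology and the atlas of the
local inverses of the projection. -/
abbrev Hopf := MulAction.orbitRel.Quotient (Dilations a) (punctured n)

variable (a) in
/-- The projection `ℂⁿ \ {0} → Hopf n a`. -/
def hopfProj (x : punctured n) : Hopf n a := Quotient.mk _ x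

theorem hopfProj_eq_iff {x y : punctured n} :
    hopfProj a x = hopfProj a y ↔ ∃ k : Dilations a, k • y = x := Quotient.eq

theorem hopf_isLocalHomeomorph : IsLocalHomeomorph (hopfProj a : punctured n → Hopf n a) :=
  isQuotientCoveringMap_quotientMk_of_properlyDiscontinuousSMul.isCoveringMap.isLocalHomeomorph

instance : IsManifold 𝓘(ℝ, Cn n) ∞ (Hopf n a) := by
  apply isManifold_of_contDiffOn
  have key : ∀ e ∈ atlas (Cn n) (Hopf n a), ∃ s : OpenPartialHomeomorph (Hopf n a) (punctured n),
      s.source = e.source ∧ (∀ z, s.symm z = hopfProj a z) ∧ (∀ q, e q = (s q : Cn n)) := by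
    rintro e ⟨q, rfl⟩
    refine ⟨hopf_isLocalHomeomorph.localInverseAt _, ?_, fun z ↦ ?_, fun q' ↦ rfl⟩
    · ext z
      simp only [TopologicalSpace.Opens.chartAt_eq, OpenPartialHomeomorph.trans_source,
        OpenPartialHomeomorph.subtypeRestr_source, chartAt_self_eq,
        OpenPartialHomeomorph.refl_source, Set.preimage_univ, Set.inter_univ]
      rfl
    · rw [IsLocalHomeomorph.localInverseAt_symm]
  intro e e' he he' y hy
  obtain ⟨s, hs, hs1, hs2⟩ := key e he
  obtain ⟨s', hs', hs1', hs2'⟩ := key e' he'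
  simp only [modelWithCornersSelf_coe, modelWithCornersSelf_coe_symm, Set.preimage_id_eq, id_eq,
    Set.range_id, Set.inter_univ, Function.comp_id, Function.id_comp,
    OpenPartialHomeomorph.coe_trans, OpenPartialHomeomorph.trans_source,
    OpenPartialHomeomorph.symm_source] at hy ⊢
  have hp : e.symm y ∈ s.source := hs ▸ e.map_target hy.1
  have hp' : e.symm y ∈ s'.source := hs' ▸ hy.2
  obtain ⟨k, hk⟩ : ∃ k : Dilations a, k • s (e.symm y) = s' (e.symm y) := by
    apply hopfProj_eq_iff.1
    rw [← hs1 (s _), ← hs1' (s' _)] at *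
    rw [s.left_inv hp, s'.left_inv hp']
  have hcont : ContinuousAt (fun z ↦ k • s (e.symm z)) y :=
    ((s.continuousAt hp).comp (e.symm.continuousAt hy.1)).const_smul k
  have hev : ∀ᶠ z in 𝓝 y, k • s (e.symm z) ∈ s'.target :=
    hcont.eventually_mem (s'.open_target.mem_nhds (hk ▸ s'.map_source hp'))
  have hev2 : ∀ᶠ z in 𝓝 y, z ∈ e.target := e.open_target.mem_nhds hy.1
  refine ContDiffAt.contDiffWithinAt ?_
  have hsm : ContDiffAt ℝ ∞ (fun z : Cn n ↦ a ^ k.exponent • z) y :=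
    contDiffAt_id.const_smul _
  refine hsm.congr_of_eventuallyEq ?_
  filter_upwards [hev, hev2] with z hz hz2
  have hz3 : e.symm z ∈ s.source := hs ▸ e.map_target hz2
  have h1 : hopfProj a (k • s (e.symm z)) = e.symm z := by
    have h2 : hopfProj a (k • s (e.symm z)) = hopfProj a (s (e.symm z)) :=
      hopfProj_eq_iff.2 ⟨k, rfl⟩
    rw [h2, ← hs1, s.left_inv hz3]
  have h3 : s' (e.symm z) = k • s (e.symm z) := by
    have h4 := s'.right_inv hz
    rwa [hs1', h1] at h4
  change e' (e.symm z) = _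
  rw [hs2', h3, coe_dilation_smul, ← hs2, e.right_inv hz2]

/-- `h : (0, ∞) → ℝ` is smooth, non-constant, satisfies `|h| < 1` and `h(a r) = h(r)`; the values
of `h` outside `(0, ∞)` are irrelevant. -/
structure IsRadialProfile (a : ℝ) (h : ℝ → ℝ) : Prop where
  smooth : ContDiffOn ℝ ∞ h (Set.Ioi 0)
  nonconst : ¬ ∃ c : ℝ, ∀ r, 0 < r → h r = c
  abs_lt_one : ∀ r, 0 < r → |h r| < 1
  periodic : ∀ r, 0 < r → h (a * r) = h r

theorem finrank_Cn (hn : 2 ≤ n) : Module.finrank ℝ (Cn n) = 2 * n - 1 + 1 := by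
  rw [← Module.finrank_mul_finrank ℝ ℂ (Cn n), finrank_euclideanSpace_fin,
    Complex.finrank_real_complex]
  omega

end Hopf

end

end LCK

open LCK

open Bundle

/-! Part (1) rests on the identity `d(Jθ) = θ ∧ Jθ - ω`, valid on a Vaisman manifold with `|θ| = 1`
(`IsVaismanWith.extDeriv1_onForm`). On every lcK manifold `∇_T J = 0`, because `2 g((∇_X J)Y, Z) =
dω(X, Y, Z) - dω(X, JY, JZ)` and the contraction of `θ ∧ ω` with `T` is `J`-invariant. If moreover
`∇T = 0`, then `[T, Y] = ∇_T Y`, so `T` is holomorphic and `𝓛_T ω = 0`. Cartan's formula with `ι_T ω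
= Jθ` then reads `0 = d(Jθ) + ω - θ ∧ Jθ`.

Given this and `dθ = 0`, `df ∧ θ = 0`, the form `ω̄ = ω + f θ ∧ Jθ` satisfies `dω̄ = θ ∧ ω - f θ ∧
d(Jθ) = (1 + f) θ ∧ ω`. This equals `(1 + f) θ ∧ ω̄` since `θ ∧ θ = 0` (`extDeriv2_deformedForm`).
The metric is `ḡ = g + f (θ² + (Jθ)²)`, positive because `T, JT` are orthonormal and `f > -1`. It
rescales the plane of `T, JT` by `1 + f`, so `ḡ(T, ·) = (1 + f) θ`: the Lee field is still `T`, with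
squared norm `1 + f`. In real dimension at least three the Lee form is determined by `ω̄`, and a
parallel form has constant norm, so on a connected manifold `ḡ` could be Vaisman only for constant
`f`.

For part (2), the coordinate changes of the Hopf manifold are locally dilations `z ↦ c z`.
Multiplication by `i`, `4 |z|⁻² ⟨·, ·⟩` and `-2 dr / r` are dilation invariant, so they have the
same expression in every chart, and the Vaisman conditions become identities on `ℂⁿ \ {0}`. The
Levi-Civita connection is written down through its Christoffel symbols. Topology comes from polar
coordinates: `log r` modulo `log a` gives the circle and `x / |x|` the sphere. -/

namespace LCK

noncomputable section


/-! ### Smoothness of tensor fields in local trivializations -/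

section Coordinates

variable {E : Type*} [NormedAddCommGroup E] [NormedSpace ℝ E]
  {M : Type*} [TopologicalSpace M] [ChartedSpace E M] [IsManifold 𝓘(ℝ, E) ∞ M]

/-- The frame `E → T_x M` given by the trivialization of the tangent bundle around `x₀`. -/
abbrev frame (x₀ x : M) : E →L[ℝ] TangentSpace 𝓘(ℝ, E) x :=
  (trivializationAt E (TangentSpace 𝓘(ℝ, E)) x₀).symmL ℝ x

/-- The coframe `T_x M → E` given by the trivialization of the tangent bundle around `x₀`. -/
abbrev coframe (x₀ x : M) : TangentSpace 𝓘(ℝ, E) x →L[ℝ] E :=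
  (trivializationAt E (TangentSpace 𝓘(ℝ, E)) x₀).continuousLinearMapAt ℝ x

theorem frame_coframe {x₀ x : M} (hx : x ∈ (chartAt E x₀).source) (v : TangentSpace 𝓘(ℝ, E) x) :
    frame x₀ x (coframe x₀ x v) = v :=
  Trivialization.symmL_continuousLinearMapAt _ hx v

theorem coframe_frame {x₀ x : M} (hx : x ∈ (chartAt E x₀).source) (v : E) :
    coframe x₀ x (frame x₀ x v) = v :=
  Trivialization.continuousLinearMapAt_symmL _ hx v

/-- This and the next three criteria replace smoothness of a bundle section by smoothness of a map
into a fixed normed space, where sums, products and inverses can be formed. -/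
theorem smoothForm1_iff {α : Form1 E M} :
    SmoothForm1 α ↔ ∀ x₀ : M, ContMDiffAt 𝓘(ℝ, E) 𝓘(ℝ, E →L[ℝ] ℝ) ∞
      (fun x ↦ (α x).comp (frame x₀ x)) x₀ := by
  refine forall_congr' fun x₀ ↦ ?_
  rw [contMDiffAt_section]
  apply Filter.EventuallyEq.contMDiffAt_iff
  filter_upwards [] with x
  ext v
  simp [hom_trivializationAt_apply, ContinuousLinearMap.inCoordinates]

theorem smoothVField_iff {X : VField E M} :
    SmoothVField X ↔ ∀ x₀ : M, ContMDiffAt 𝓘(ℝ, E) 𝓘(ℝ, E) ∞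
      (fun x ↦ coframe x₀ x (X x)) x₀ := by
  refine forall_congr' fun x₀ ↦ ?_
  rw [contMDiffAt_section]
  apply Filter.EventuallyEq.contMDiffAt_iff
  filter_upwards [(chartAt E x₀).open_source.mem_nhds (mem_chart_source E x₀)] with x hx
  rw [Trivialization.continuousLinearMapAt_apply, Trivialization.coe_linearMapAt_of_mem _ hx]

theorem smoothEnd_iff {A : EndField E M} :
    ContMDiff 𝓘(ℝ, E) (𝓘(ℝ, E).prod 𝓘(ℝ, E →L[ℝ] E)) ∞
      (fun x ↦ TotalSpace.mk' (E →L[ℝ] E)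
      (E := fun x : M ↦ TangentSpace 𝓘(ℝ, E) x →L[ℝ] TangentSpace 𝓘(ℝ, E) x) x (A x)) ↔
    ∀ x₀ : M, ContMDiffAt 𝓘(ℝ, E) 𝓘(ℝ, E →L[ℝ] E) ∞
      (fun x ↦ (coframe x₀ x).comp ((A x).comp (frame x₀ x))) x₀ := by
  refine forall_congr' fun x₀ ↦ ?_
  rw [contMDiffAt_section]
  apply Filter.EventuallyEq.contMDiffAt_iff
  filter_upwards [] with x
  simp [hom_trivializationAt_apply, ContinuousLinearMap.inCoordinates]

/-- The bilinear form `B` at `x`, read in the trivialization of the tangent bundle around `x₀`. -/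
def coordForm2 (B : Form2 E M) (x₀ x : M) : E →L[ℝ] E →L[ℝ] ℝ :=
  (ContinuousLinearMap.precomp ℝ (frame x₀ x)).comp ((B x).comp (frame x₀ x))

theorem coordForm2_apply (B : Form2 E M) (x₀ x : M) (v w : E) :
    coordForm2 B x₀ x v w = B x (frame x₀ x v) (frame x₀ x w) := rfl

theorem smoothForm2_iff {B : Form2 E M} :
    ContMDiff 𝓘(ℝ, E) (𝓘(ℝ, E).prod 𝓘(ℝ, E →L[ℝ] E →L[ℝ] ℝ)) ∞
      (fun x ↦ TotalSpace.mk' (E →L[ℝ] E →L[ℝ] ℝ)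
      (E := fun x : M ↦ TangentSpace 𝓘(ℝ, E) x →L[ℝ] TangentSpace 𝓘(ℝ, E) x →L[ℝ] ℝ) x (B x)) ↔
    ∀ x₀ : M, ContMDiffAt 𝓘(ℝ, E) 𝓘(ℝ, E →L[ℝ] E →L[ℝ] ℝ) ∞
      (fun x ↦ coordForm2 B x₀ x) x₀ := by
  refine forall_congr' fun x₀ ↦ ?_
  rw [contMDiffAt_section]
  apply Filter.EventuallyEq.contMDiffAt_iff
  filter_upwards [(chartAt E x₀).open_source.mem_nhds (mem_chart_source E x₀)] with x hx
  ext v w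
  rw [hom_trivializationAt_apply]
  simp only [ContinuousLinearMap.inCoordinates]
  rw [ContinuousLinearMap.comp_apply, ContinuousLinearMap.comp_apply]
  rw [Trivialization.continuousLinearMapAt_apply, Trivialization.coe_linearMapAt_of_mem]
  -- The bundle of bilinear forms is an iterated Hom bundle; the outer trivialization is already
  -- unfolded, and this unfolds the inner one.
  · refine (DFunLike.congr_fun (congrArg Prod.snd (hom_trivializationAt_apply (RingHom.id ℝ)
      (E₁ := fun x : M ↦ TangentSpace 𝓘(ℝ, E) x) (E₂ := Bundle.Trivial M ℝ) x₀
      ⟨x, B x (frame x₀ x v)⟩)) w).trans ?_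
    simp [ContinuousLinearMap.inCoordinates, coordForm2_apply]
  · exact ⟨hx, trivial⟩

end Coordinates

/-! ### Pointwise calculus of vector fields, forms and functions -/

section Differentiability

variable {E : Type*} [NormedAddCommGroup E] [NormedSpace ℝ E]
  {M : Type*} [TopologicalSpace M] [ChartedSpace E M] [IsManifold 𝓘(ℝ, E) ∞ M]

theorem SmoothForm1.mdifferentiableAt_apply {α : Form1 E M} (hα : SmoothForm1 α) {X : VField E M}
    {x : M} (hX : DiffAt X x) : MDifferentiableAt 𝓘(ℝ, E) 𝓘(ℝ, ℝ) (fun y ↦ α y (X y)) x := by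
  have h := MDifferentiableAt.clm_bundle_apply (F₂ := ℝ) (E₂ := Bundle.Trivial M ℝ) (b := id)
    ((hα x).mdifferentiableAt (by simp)) hX
  exact ((mdifferentiableAt_totalSpace _ _).1 h).2

theorem mdifferentiableAt_inner (g : RMetric E M) {X Y : VField E M}
    {x : M} (hX : DiffAt X x) (hY : DiffAt Y x) :
    MDifferentiableAt 𝓘(ℝ, E) 𝓘(ℝ, ℝ) (fun y ↦ g.inner y (X y) (Y y)) x := by
  have h := MDifferentiableAt.clm_bundle_apply₂ (F₃ := ℝ) (E₃ := Bundle.Trivial M ℝ) (b := id)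
    ((g.contMDiff x).mdifferentiableAt (by simp)) hX hY
  exact ((mdifferentiableAt_totalSpace _ _).1 h).2

theorem ComplexStructure.diffAt (J : ComplexStructure E M) {X : VField E M}
    {x : M} (hX : DiffAt X x) : DiffAt (fun y ↦ J y (X y)) x :=
  MDifferentiableAt.clm_bundle_apply (b := id)
    ((J.smooth x).mdifferentiableAt (by simp)) hX

theorem SmoothVField.diffAt {X : VField E M} (hX : SmoothVField X) (x : M) : DiffAt X x :=
  (hX x).mdifferentiableAt (by simp)

/-- Every tangent vector is the value of a vector field that is differentiable there. -/
theorem exists_diffAt_eq (x : M) (v : TangentSpace 𝓘(ℝ, E) x) :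
    ∃ X : VField E M, DiffAt X x ∧ X x = v :=
  ⟨FiberBundle.extend E v, FiberBundle.mdifferentiableAt_extend _ _ v,
    FiberBundle.extend_apply_self E v⟩

theorem inner_left_ext (g : RMetric E M) {x : M} {v w : TangentSpace 𝓘(ℝ, E) x}
    (h : ∀ u, g.inner x v u = g.inner x w u) : v = w := by
  by_contra hne
  have h1 := g.pos x (v - w) (sub_ne_zero.2 hne)
  rw [(g.inner x).map_sub, sub_apply, h, sub_self] at h1
  exact lt_irrefl _ h1

end Differentiability

section Diff

variable {E : Type*} [NormedAddCommGroup E] [NormedSpace ℝ E]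
  {M : Type*} [TopologicalSpace M] [ChartedSpace E M] {f h : M → ℝ} {x : M}

theorem diff_add (hf : MDifferentiableAt 𝓘(ℝ, E) 𝓘(ℝ, ℝ) f x)
    (hh : MDifferentiableAt 𝓘(ℝ, E) 𝓘(ℝ, ℝ) h x) :
    diff (E := E) (fun y ↦ f y + h y) x = diff f x + diff h x := mvfderiv_fun_add hf hh

theorem diff_sub (hf : MDifferentiableAt 𝓘(ℝ, E) 𝓘(ℝ, ℝ) f x)
    (hh : MDifferentiableAt 𝓘(ℝ, E) 𝓘(ℝ, ℝ) h x) :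
    diff (E := E) (fun y ↦ f y - h y) x = diff f x - diff h x := mvfderiv_fun_sub hf hh

theorem diff_mul (hf : MDifferentiableAt 𝓘(ℝ, E) 𝓘(ℝ, ℝ) f x)
    (hh : MDifferentiableAt 𝓘(ℝ, E) 𝓘(ℝ, ℝ) h x) :
    diff (E := E) (fun y ↦ f y * h y) x = f x • diff h x + h x • diff f x :=
  mvfderiv_fun_mul hf hh

theorem diff_neg : diff (E := E) (fun y ↦ -f y) x = -diff f x := mvfderiv_fun_neg

theorem diff_const (c : ℝ) : diff (E := E) (fun _ : M ↦ c) x = 0 := mvfderiv_const c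

theorem wedge_apply (α β : Form1 E M) (x : M) (v w : TangentSpace 𝓘(ℝ, E) x) :
    wedge α β x v w = α x v * β x w - β x v * α x w := rfl

end Diff

/-! ### Metric duality -/

section Sharp

variable {E : Type*} [NormedAddCommGroup E] [NormedSpace ℝ E] [FiniteDimensional ℝ E]
  {M : Type*} [TopologicalSpace M] [ChartedSpace E M] [IsManifold 𝓘(ℝ, E) ∞ M]

theorem sharp_eq_iff (g : RMetric E M) (α : Form1 E M) {x : M} {v : TangentSpace 𝓘(ℝ, E) x} :
    sharp g α x = v ↔ ∀ w, g.inner x v w = α x w :=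
  ⟨fun h w ↦ h ▸ inner_sharp g α x w,
    fun h ↦ inner_left_ext g fun w ↦ by rw [inner_sharp, h]⟩

/-- In a trivialization, `α♯` is the inverse of the Gram operator `G x : E → E*` applied to the
covector. Positivity makes `G x` invertible, and inversion is smooth at invertible operators. -/
theorem smoothVField_sharp (g : RMetric E M) {α : Form1 E M} (hα : SmoothForm1 α) :
    SmoothVField (sharp g α) := by
  rw [smoothVField_iff]
  intro x₀
  have hG := smoothForm2_iff.1 g.contMDiff x₀
  have hA := smoothForm1_iff.1 hα x₀
  set G : M → E →L[ℝ] E →L[ℝ] ℝ := fun x ↦ coordForm2 g.inner x₀ x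
    with hGdef
  have hinj : ∀ x ∈ (chartAt E x₀).source, ∃ e : E ≃L[ℝ] (E →L[ℝ] ℝ),
      (e : E →L[ℝ] E →L[ℝ] ℝ) = G x := by
    intro x hx
    have hinj : Function.Injective (G x) := by
      rw [injective_iff_map_eq_zero]
      intro v hv
      by_contra hne
      have hne' : frame x₀ x v ≠ 0 := fun h0 ↦ hne (by
        rw [← coframe_frame hx v, h0, map_zero])
      exact (g.pos x _ hne').ne' (DFunLike.congr_fun hv v)
    have hfin : Module.finrank ℝ E = Module.finrank ℝ (E →L[ℝ] ℝ) := by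
      rw [← (LinearMap.toContinuousLinearMap : (E →ₗ[ℝ] ℝ) ≃ₗ[ℝ] _).finrank_eq]
      exact (Subspace.dual_finrank_eq (K := ℝ)).symm
    refine ⟨(LinearEquiv.ofInjectiveOfFinrankEq (G x).toLinearMap hinj
      hfin).toContinuousLinearEquiv, ?_⟩
    ext v w
    rfl
  have hinv : ContMDiffAt 𝓘(ℝ, E) 𝓘(ℝ, (E →L[ℝ] ℝ) →L[ℝ] E) ∞
      (fun x ↦ ContinuousLinearMap.inverse (G x)) x₀ := by
    obtain ⟨e, he⟩ := hinj x₀ (mem_chart_source E x₀)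
    have := contDiffAt_map_inverse (n := ∞) e
    rw [he] at this
    exact this.contMDiffAt.comp x₀ hG
  refine (hinv.clm_apply hA).congr_of_eventuallyEq ?_
  filter_upwards [(chartAt E x₀).open_source.mem_nhds (mem_chart_source E x₀)] with x hx
  obtain ⟨e, he⟩ := hinj x hx
  rw [← he, ContinuousLinearMap.inverse_equiv]
  apply e.injective
  rw [ContinuousLinearEquiv.coe_coe, e.apply_symm_apply]
  ext w
  change (e : E →L[ℝ] E →L[ℝ] ℝ) (coframe x₀ x (sharp g α x)) w = _
  rw [he]
  rw [hGdef, coordForm2_apply, ContinuousLinearMap.comp_apply, frame_coframe hx, inner_sharp]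

end Sharp


/-! ### The covariant derivative of `J` on a Hermitian manifold -/

section LeviCivita

variable {E : Type*} [NormedAddCommGroup E] [NormedSpace ℝ E]
  {M : Type*} [TopologicalSpace M] [ChartedSpace E M] [IsManifold 𝓘(ℝ, E) ∞ M]
  {J : ComplexStructure E M} {g : RMetric E M}
  {D : CovariantDerivative 𝓘(ℝ, E) E (fun x : M ↦ TangentSpace 𝓘(ℝ, E) x)}

theorem IsHermitian.inner_left (h : IsHermitian J g) (x : M) (v w : TangentSpace 𝓘(ℝ, E) x) :
    g.inner x (J x v) w = -g.inner x v (J x w) := by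
  have h1 := h x v (J x w)
  rw [J.sq, map_neg] at h1
  rw [← h1, neg_neg]

theorem fundamentalForm_apply (x : M) (v w : TangentSpace 𝓘(ℝ, E) x) :
    fundamentalForm J g x v w = g.inner x (J x v) w := rfl

theorem onForm_apply {θ : Form1 E M} (x : M) (v : TangentSpace 𝓘(ℝ, E) x) :
    J.onForm θ x v = -θ x (J x v) := rfl

theorem covariantDerivative_neg {Y : VField E M} {x : M} (hY : DiffAt Y x) :
    D (fun y ↦ -Y y) x = -D Y x := by
  have h := D.isCovariantDerivativeOn.smul_const (-1 : ℝ) hY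
  have h2 : ((-1 : ℝ) • Y : VField E M) = fun y ↦ -Y y := by
    funext y
    simp
  rw [h2] at h
  rw [h, neg_one_smul]

variable (J D) in
/-- The covariant derivative of `J`: `(∇_v J) Y = ∇_v (J Y) - J (∇_v Y)`. -/
def covJ (Y : VField E M) (x : M) (v : TangentSpace 𝓘(ℝ, E) x) : TangentSpace 𝓘(ℝ, E) x :=
  D (fun y ↦ J y (Y y)) x v - J x (D Y x v)

/-- Obtained by differentiating `g(JY, Z) = -g(Y, JZ)`. -/
theorem covJ_skew (hg : IsHermitian J g) (hD : IsLeviCivita g D) {x : M} {Y Z : VField E M}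
    (hY : DiffAt Y x) (hZ : DiffAt Z x) (v : TangentSpace 𝓘(ℝ, E) x) :
    g.inner x (covJ J D Y x v) (Z x) = -g.inner x (covJ J D Z x v) (Y x) := by
  have h1 := hD.metric x v _ _ (J.diffAt hY) hZ
  have h2 := hD.metric x v _ _ hY (J.diffAt hZ)
  have h3 : (fun y ↦ g.inner y (J y (Y y)) (Z y)) = fun y ↦ -g.inner y (Y y) (J y (Z y)) := by
    funext y
    exact hg.inner_left y _ _
  rw [h3, diff_neg, neg_apply, h2] at h1
  have h4 := hg.inner_left x (D Y x v) (Z x)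
  have h5 := hg.inner_left x (D Z x v) (Y x)
  have h6 := g.symm x (Y x) (D (fun y ↦ J y (Z y)) x v)
  have h7 := g.symm x (J x (Y x)) (D Z x v)
  simp only [covJ, map_sub, sub_apply]
  linarith

/-- Differentiating `J² = -1` shows that `∇_v J` anticommutes with `J`. -/
theorem covJ_J (hg : IsHermitian J g) {x : M} {Y : VField E M}
    (hY : DiffAt Y x) (v w : TangentSpace 𝓘(ℝ, E) x) :
    g.inner x (covJ J D (fun y ↦ J y (Y y)) x v) w = g.inner x (covJ J D Y x v) (J x w) := by
  have h1 : (fun y ↦ J y (J y (Y y))) = fun y ↦ -Y y := by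
    funext y
    exact J.sq y _
  have h2 : covJ J D (fun y ↦ J y (Y y)) x v = -J x (covJ J D Y x v) := by
    simp only [covJ]
    rw [h1, covariantDerivative_neg hY, map_sub, J.sq, neg_apply]
    abel
  rw [h2, map_neg, neg_apply, hg.inner_left, neg_neg]

/-- Metric compatibility expands the derivatives and torsion-freeness the brackets; all derivatives
of `X, Y, Z` themselves cancel, leaving the cyclic sum of `∇ω`. -/
theorem extDeriv2_fundamentalForm (hD : IsLeviCivita g D) (hg : IsHermitian J g) {x : M}
    {X Y Z : VField E M} (hX : DiffAt X x) (hY : DiffAt Y x) (hZ : DiffAt Z x) :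
    extDeriv2 (fundamentalForm J g) X Y Z x = g.inner x (covJ J D Y x (X x)) (Z x)
      + g.inner x (covJ J D Z x (Y x)) (X x) + g.inner x (covJ J D X x (Z x)) (Y x) := by
  have e1 := hD.metric x (X x) _ _ (J.diffAt hY) hZ
  have e2 := hD.metric x (Y x) _ _ (J.diffAt hX) hZ
  have e3 := hD.metric x (Z x) _ _ (J.diffAt hX) hY
  have s1 := covJ_skew hg hD hX hZ (Y x)
  simp only [extDeriv2, fundamentalForm_apply, ← hD.torsion_free x X Y hX hY,
    ← hD.torsion_free x X Z hX hZ, ← hD.torsion_free x Y Z hY hZ]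
  rw [e1, e2, e3]
  simp only [covJ, map_sub, sub_apply] at s1 ⊢
  have a1 := hg.inner_left x (Y x) (D Z x (X x))
  have a2 := hg.inner_left x (D Z x (X x)) (Y x)
  have a3 := hg.inner_left x (X x) (D Z x (Y x))
  have a4 := hg.inner_left x (D Z x (Y x)) (X x)
  have a5 := hg.inner_left x (X x) (D Y x (Z x))
  have a6 := hg.inner_left x (D Y x (Z x)) (X x)
  have a7 := g.symm x (J x (Y x)) (D Z x (X x))
  have a8 := g.symm x (J x (X x)) (D Z x (Y x))
  have a9 := g.symm x (J x (X x)) (D Y x (Z x))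
  linarith

/-- The Nijenhuis tensor of `J` in terms of `∇ J`. -/
theorem covJ_nijenhuis (hD : IsLeviCivita g D) {x : M} {X Y : VField E M}
    (hX : DiffAt X x) (hY : DiffAt Y x) :
    covJ J D Y x (J x (X x)) - covJ J D X x (J x (Y x))
      + J x (covJ J D X x (Y x)) - J x (covJ J D Y x (X x)) = 0 := by
  have h := J.nijenhuis x X Y hX hY
  rw [← hD.torsion_free x _ _ (J.diffAt hX) (J.diffAt hY), ← hD.torsion_free x _ _ (J.diffAt hX) hY,
    ← hD.torsion_free x _ _ hX (J.diffAt hY), ← hD.torsion_free x _ _ hX hY] at h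
  simp only [covJ, map_sub, J.sq] at h ⊢
  rw [← h]
  abel

/-- `2 g((∇_X J) Y, Z) = dω(X, Y, Z) - dω(X, JY, JZ)`. -/
theorem two_mul_inner_covJ (hD : IsLeviCivita g D) (hg : IsHermitian J g) {x : M}
    {X Y Z : VField E M} (hX : DiffAt X x) (hY : DiffAt Y x) (hZ : DiffAt Z x) :
    2 * g.inner x (covJ J D Y x (X x)) (Z x) = extDeriv2 (fundamentalForm J g) X Y Z x
      - extDeriv2 (fundamentalForm J g) X (fun y ↦ J y (Y y)) (fun y ↦ J y (Z y)) x := by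
  rw [extDeriv2_fundamentalForm hD hg hX hY hZ,
    extDeriv2_fundamentalForm hD hg hX (J.diffAt hY) (J.diffAt hZ)]
  -- In the difference, the two terms differentiating along `X` add up, as `∇_X J` anticommutes with
  -- `J`. The terms along `Y, Z, JY, JZ` cancel by the Nijenhuis identity for `Y, Z` paired with
  -- `JX`.
  have hN := congrArg (fun u ↦ g.inner x u (J x (X x))) (covJ_nijenhuis (J := J) hD hY hZ)
  simp only [map_add, map_sub, add_apply, sub_apply, map_zero, zero_apply] at hN
  rw [hg x, hg x] at hN
  have b1 := covJ_J (D := D) hg hY (X x) (J x (Z x))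
  rw [J.sq, map_neg] at b1
  have b2 := covJ_J (D := D) hg hZ (J x (Y x)) (X x)
  have b3 := covJ_skew hg hD hX (J.diffAt hY) (J x (Z x))
  have b4 := covJ_J (D := D) hg hY (J x (Z x)) (X x)
  have b5 := covJ_skew hg hD hX hY (Z x)
  linarith

end LeviCivita

/-! ### The Lee field of a Vaisman manifold -/

section Vaisman

variable {E : Type*} [NormedAddCommGroup E] [NormedSpace ℝ E] [FiniteDimensional ℝ E]
  {M : Type*} [TopologicalSpace M] [ChartedSpace E M] [IsManifold 𝓘(ℝ, E) ∞ M]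
  {J : ComplexStructure E M} {g : RMetric E M} {θ : Form1 E M}
  {D : CovariantDerivative 𝓘(ℝ, E) E (fun x : M ↦ TangentSpace 𝓘(ℝ, E) x)}

theorem fundamentalForm_sharp (hg : IsHermitian J g) (x : M) (v : TangentSpace 𝓘(ℝ, E) x) :
    fundamentalForm J g x (sharp g θ x) v = J.onForm θ x v := by
  rw [fundamentalForm_apply, hg.inner_left, inner_sharp, onForm_apply]

/-- Subtract the parallelism of `θ` from the metric Leibniz rule for `θ(Y) = g(θ♯, Y)`: what remains
is `g(∇_v θ♯, Y) = 0`. -/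
theorem cov_sharp_eq_zero (hD : IsLeviCivita g D) (hθ : SmoothForm1 θ)
    (hp : ∀ (x : M) (v : TangentSpace 𝓘(ℝ, E) x) (Y : VField E M), DiffAt Y x →
        diff (fun y ↦ θ y (Y y)) x v - θ x (D Y x v) = 0) (x : M) (v : TangentSpace 𝓘(ℝ, E) x) :
    D (sharp g θ) x v = 0 := by
  apply inner_left_ext g
  intro u
  obtain ⟨Y, hY, rfl⟩ := exists_diffAt_eq x u
  have h1 := hD.metric x v _ _ ((smoothVField_sharp g hθ).diffAt x) hY
  have h2 := hp x v Y hY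
  simp only [inner_sharp] at h1
  simp only [map_zero, zero_apply]
  linarith

/-- By `two_mul_inner_covJ` it suffices that `(θ ∧ ω)(T, Y, Z) = |θ|² ω(Y, Z) - (θ ∧ Jθ)(Y, Z)` does
not change when `Y, Z` are replaced by `JY, JZ`. Parallelism of `θ` plays no role. -/
theorem IsLCKWith.covJ_sharp (h : IsLCKWith J g θ) (hD : IsLeviCivita g D) {x : M}
    {Y : VField E M} (hY : DiffAt Y x) : covJ J D Y x (sharp g θ x) = 0 := by
  apply inner_left_ext g
  intro u
  obtain ⟨Z, hZ, rfl⟩ := exists_diffAt_eq x u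
  have hT := (smoothVField_sharp g h.smooth).diffAt x
  have h1 := two_mul_inner_covJ (J := J) hD h.hermitian hT hY hZ
  rw [h.lee x _ _ _ hT hY hZ, h.lee x _ _ _ hT (J.diffAt hY) (J.diffAt hZ)] at h1
  simp only [wedge12, fundamentalForm_sharp h.hermitian, onForm_apply, J.sq] at h1
  simp only [fundamentalForm_apply, J.sq, map_neg, neg_apply] at h1
  rw [h.hermitian.inner_left x (Y x) (Z x)] at h1
  simp only [map_zero, zero_apply]
  linarith

/-- Since `∇T = 0`, `[T, Y] = ∇_T Y`; hence `[T, JY] - J[T, Y] = (∇_T J)Y`, which vanishes. -/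
theorem IsVaismanWith.isHolomorphic_sharp (h : IsVaismanWith J g θ) :
    IsHolomorphic J (sharp g θ) := by
  obtain ⟨h, D, hD, hp⟩ := h
  refine ⟨smoothVField_sharp g h.smooth, fun x Y hY ↦ ?_⟩
  have hT := (smoothVField_sharp g h.smooth).diffAt x
  rw [← hD.torsion_free x _ _ hT (J.diffAt hY), ← hD.torsion_free x _ _ hT hY,
    cov_sharp_eq_zero hD h.smooth hp, cov_sharp_eq_zero hD h.smooth hp, sub_zero, sub_zero]
  exact sub_eq_zero.1 (h.covJ_sharp hD hY)

/-- `d(Jθ) = θ ∧ Jθ - ω` on a Vaisman manifold with `|θ| = 1`. -/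
theorem IsVaismanWith.extDeriv1_onForm (h : IsVaismanWith J g θ)
    (hn : ∀ x, θ x (sharp g θ x) = 1) {x : M} {X Y : VField E M} (hX : DiffAt X x)
    (hY : DiffAt Y x) :
    extDeriv1 (J.onForm θ) X Y x =
      wedge θ (J.onForm θ) x (X x) (Y x) - fundamentalForm J g x (X x) (Y x) := by
  have hhol := h.isHolomorphic_sharp
  obtain ⟨h, D, hD, hp⟩ := h
  have hT := (smoothVField_sharp g h.smooth).diffAt x
  have h1 := h.lee x _ _ _ hT hX hY
  have h0 := hD.torsion_free x _ _ hT hX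
  have h0' := hD.torsion_free x _ _ hT hY
  have h0'' := hD.torsion_free x _ _ hT (J.diffAt hX)
  rw [cov_sharp_eq_zero hD h.smooth hp, sub_zero] at h0 h0' h0''
  -- After the rewriting this is `𝓛_T ω = 0`: `T(ω(X, Y)) = ω([T, X], Y) + ω(X, [T, Y])`. Inserted
  -- into `dω(T, X, Y)`, it leaves `-d(Jθ)(X, Y)`, which is Cartan's formula.
  have h2 := hD.metric x (sharp g θ x) _ _ (J.diffAt hX) hY
  have h3 := hhol.2 x X hX
  rw [h0'', h0', h3] at h2
  simp only [extDeriv2, wedge12, fundamentalForm_sharp h.hermitian, hn] at h1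
  simp only [extDeriv1, wedge, sub_apply, ContinuousLinearMap.smulRight_apply, smul_eq_mul,
    smul_apply]
  have h4 := h.hermitian.inner_left x (X x) (bracket (sharp g θ) Y x)
  have h5 : fundamentalForm J g x (bracket X Y x) (sharp g θ x)
      = - J.onForm θ x (bracket X Y x) := by
    rw [fundamentalForm_apply, g.symm, inner_sharp, onForm_apply, neg_neg]
  have h6 := g.symm x (J x (bracket (sharp g θ) Y x)) (X x)
  simp only [fundamentalForm_apply] at h1 h5 ⊢
  linarith

end Vaisman


/-! ### The deformed metric and its fundamental form -/

/-- The unit ball of a positive definite bilinear form on a finite-dimensional space is bounded. -/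
theorem isVonNBounded_of_posDef {E : Type*} [NormedAddCommGroup E] [NormedSpace ℝ E]
    [FiniteDimensional ℝ E] (B : E →L[ℝ] E →L[ℝ] ℝ) (hB : ∀ v, v ≠ 0 → 0 < B v v) :
    Bornology.IsVonNBounded ℝ {v : E | B v v < 1} := by
  rw [NormedSpace.isVonNBounded_iff]
  have hcont : Continuous fun v : E ↦ B v v := by fun_prop
  -- On the zero space the unit sphere is empty and there is no minimum to take. Otherwise the
  -- minimum of `B v v` over the sphere bounds the unit ball of `B`.
  obtain hE | ⟨⟨u, hu⟩⟩ := isEmpty_or_nonempty (Metric.sphere (0 : E) 1)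
  · have h0 : ∀ v : E, v = 0 := by
      intro v
      by_contra hv
      exact hE.false ⟨‖v‖⁻¹ • v, by simp [norm_smul, hv]⟩
    refine (Bornology.isBounded_singleton (x := (0 : E))).subset fun v _ ↦ h0 v
  obtain ⟨m, hm, hmin⟩ := (isCompact_sphere (0 : E) 1).exists_isMinOn ⟨u, hu⟩ hcont.continuousOn
  have hm0 : m ≠ 0 := by
    rintro rfl
    simp at hm
  have hpos := hB m hm0
  refine (Metric.isBounded_closedBall (x := (0 : E)) (r := √(1 / B m m))).subset fun v hv ↦ ?_
  rw [mem_closedBall_zero_iff]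
  obtain rfl | hv0 := eq_or_ne v 0
  · simp
  have hnv : 0 < ‖v‖ := norm_pos_iff.2 hv0
  have h1 : B m m ≤ B (‖v‖⁻¹ • v) (‖v‖⁻¹ • v) :=
    hmin (by simp [norm_smul, hv0] : ‖v‖⁻¹ • v ∈ Metric.sphere (0 : E) 1)
  simp only [map_smul, smul_apply, smul_eq_mul] at h1
  apply Real.le_sqrt_of_sq_le
  rw [le_div_iff₀ hpos]
  have h2 : ‖v‖ ^ 2 * B m m ≤ ‖v‖ ^ 2 * (‖v‖⁻¹ * (‖v‖⁻¹ * B v v)) := by gcongr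
  have h3 : ‖v‖ ^ 2 * (‖v‖⁻¹ * (‖v‖⁻¹ * B v v)) = B v v := by field_simp
  have h4 : B v v < 1 := hv
  linarith

section Deformation

variable {E : Type*} [NormedAddCommGroup E] [NormedSpace ℝ E]
  {M : Type*} [TopologicalSpace M] [ChartedSpace E M] [IsManifold 𝓘(ℝ, E) ∞ M]
  {J : ComplexStructure E M} {g : RMetric E M} {θ : Form1 E M} {f : M → ℝ}

theorem smoothForm1_onForm (J : ComplexStructure E M) (hθ : SmoothForm1 θ) :
    SmoothForm1 (J.onForm θ) := by
  rw [smoothForm1_iff] at hθ ⊢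
  intro x₀
  refine ((hθ x₀).clm_comp (smoothEnd_iff.1 J.smooth x₀)).neg.congr_of_eventuallyEq ?_
  filter_upwards [(chartAt E x₀).open_source.mem_nhds (mem_chart_source E x₀)] with x hx
  ext v
  change -θ x (J x (frame x₀ x v)) = -θ x (frame x₀ x (coframe x₀ x (J x (frame x₀ x v))))
  rw [frame_coframe hx]

theorem smoothForm1_smul (hf : ContMDiff 𝓘(ℝ, E) 𝓘(ℝ, ℝ) ∞ f) (hθ : SmoothForm1 θ) :
    SmoothForm1 (fun x ↦ f x • θ x) := by
  rw [smoothForm1_iff] at hθ ⊢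
  intro x₀
  exact (hf x₀).smul (hθ x₀)

theorem deformedForm_apply (x : M) (v w : TangentSpace 𝓘(ℝ, E) x) :
    deformedForm J g θ f x v w = fundamentalForm J g x v w
      + f x * (θ x v * J.onForm θ x w - J.onForm θ x v * θ x w) := rfl

/-- Since `Jθ(Jw) = θ(w)` and `θ(Jw) = -Jθ(w)`, the wedge product turns into a sum of squares, which
makes the symmetry of the deformed metric visible. -/
theorem deformedForm_apply_J (hg : IsHermitian J g) (x : M) (v w : TangentSpace 𝓘(ℝ, E) x) :
    deformedForm J g θ f x v (J x w) = g.inner x v w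
      + f x * (θ x v * θ x w + J.onForm θ x v * J.onForm θ x w) := by
  rw [deformedForm_apply, fundamentalForm_apply, hg]
  simp only [onForm_apply, J.sq, map_neg]
  ring

/-- The Leibniz rule `d((1 + f) θ) = df ∧ θ + (1 + f) dθ`. -/
theorem Closed1.smul_of_wedge_eq_zero
    (hclosed : Closed1 θ) (hθ : SmoothForm1 θ) (hf : ContMDiff 𝓘(ℝ, E) 𝓘(ℝ, ℝ) ∞ f)
    (hw : ∀ x, wedge (diff f) θ x = 0) : Closed1 (fun x ↦ (1 + f x) • θ x) := by
  intro x X Y hX hY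
  have hfx : MDifferentiableAt 𝓘(ℝ, E) 𝓘(ℝ, ℝ) f x := (hf x).mdifferentiableAt (by simp)
  have hf1 : MDifferentiableAt 𝓘(ℝ, E) 𝓘(ℝ, ℝ) (fun y ↦ 1 + f y) x :=
    (contMDiff_const.add hf x).mdifferentiableAt (by simp)
  have h1 := hclosed x X Y hX hY
  have h2 : wedge (diff f) θ x (X x) (Y x) = 0 := by rw [hw]; rfl
  have h3 : diff (E := E) (fun y ↦ 1 + f y) x = diff f x := by
    rw [diff_add mdifferentiableAt_const hfx, diff_const, zero_add]
  simp only [extDeriv1, smul_apply, smul_eq_mul] at h1 ⊢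
  rw [diff_mul hf1 (hθ.mdifferentiableAt_apply hX), diff_mul hf1 (hθ.mdifferentiableAt_apply hY),
    h3]
  rw [wedge_apply] at h2
  simp only [add_apply, smul_apply, smul_eq_mul]
  linear_combination (1 + f x) * h1 + h2

theorem diff_deformedForm (hθ : SmoothForm1 θ)
    (hf : ContMDiff 𝓘(ℝ, E) 𝓘(ℝ, ℝ) ∞ f) {x : M}
    {Y Z : VField E M} (hY : DiffAt Y x) (hZ : DiffAt Z x) (v : TangentSpace 𝓘(ℝ, E) x) :
    diff (fun y ↦ deformedForm J g θ f y (Y y) (Z y)) x v =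
      diff (fun y ↦ fundamentalForm J g y (Y y) (Z y)) x v
      + diff f x v * (θ x (Y x) * J.onForm θ x (Z x) - J.onForm θ x (Y x) * θ x (Z x))
      + f x * (diff (fun y ↦ θ y (Y y)) x v * J.onForm θ x (Z x)
        + θ x (Y x) * diff (fun y ↦ J.onForm θ y (Z y)) x v
        - diff (fun y ↦ J.onForm θ y (Y y)) x v * θ x (Z x)
        - J.onForm θ x (Y x) * diff (fun y ↦ θ y (Z y)) x v) := by
  have hfx : MDifferentiableAt 𝓘(ℝ, E) 𝓘(ℝ, ℝ) f x := (hf x).mdifferentiableAt (by simp)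
  have hJ := smoothForm1_onForm J hθ
  have h1 := hθ.mdifferentiableAt_apply hY
  have h2 := hθ.mdifferentiableAt_apply hZ
  have h3 := hJ.mdifferentiableAt_apply hY
  have h4 := hJ.mdifferentiableAt_apply hZ
  have h5 : MDifferentiableAt 𝓘(ℝ, E) 𝓘(ℝ, ℝ) (fun y ↦ fundamentalForm J g y (Y y) (Z y)) x :=
    mdifferentiableAt_inner g (J.diffAt hY) hZ
  have h6 : MDifferentiableAt 𝓘(ℝ, E) 𝓘(ℝ, ℝ) (fun y ↦ θ y (Y y) * J.onForm θ y (Z y)) x :=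
    h1.mul h4
  have h7 : MDifferentiableAt 𝓘(ℝ, E) 𝓘(ℝ, ℝ) (fun y ↦ J.onForm θ y (Y y) * θ y (Z y)) x :=
    h3.mul h2
  have h8 : MDifferentiableAt 𝓘(ℝ, E) 𝓘(ℝ, ℝ) (fun y ↦ θ y (Y y) * J.onForm θ y (Z y)
      - J.onForm θ y (Y y) * θ y (Z y)) x := h6.sub h7
  have h9 : MDifferentiableAt 𝓘(ℝ, E) 𝓘(ℝ, ℝ) (fun y ↦ f y * (θ y (Y y) * J.onForm θ y (Z y)
      - J.onForm θ y (Y y) * θ y (Z y))) x := hfx.mul h8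
  simp only [deformedForm_apply]
  rw [diff_add h5 h9, diff_mul hfx h8, diff_sub h6 h7, diff_mul h1 h4,
    diff_mul h3 h2]
  simp only [add_apply, sub_apply, smul_apply, smul_eq_mul]
  ring

theorem contMDiff_deformedMetric (hθ : SmoothForm1 θ) (hf : ContMDiff 𝓘(ℝ, E) 𝓘(ℝ, ℝ) ∞ f) :
    ContMDiff 𝓘(ℝ, E) (𝓘(ℝ, E).prod 𝓘(ℝ, E →L[ℝ] E →L[ℝ] ℝ)) ∞
      (fun x ↦ TotalSpace.mk' (E →L[ℝ] E →L[ℝ] ℝ)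
      (E := fun x : M ↦ TangentSpace 𝓘(ℝ, E) x →L[ℝ] TangentSpace 𝓘(ℝ, E) x →L[ℝ] ℝ) x
        (g.inner x + f x • ((θ x).smulRight (θ x) +
          (J.onForm θ x).smulRight (J.onForm θ x)))) := by
  rw [smoothForm2_iff]
  intro x₀
  have h1 := smoothForm2_iff.1 g.contMDiff x₀
  have h2 := smoothForm1_iff.1 hθ x₀
  have h3 := smoothForm1_iff.1 (smoothForm1_onForm J hθ) x₀
  have h4 : ∀ {a : M → E →L[ℝ] ℝ}, ContMDiffAt 𝓘(ℝ, E) 𝓘(ℝ, E →L[ℝ] ℝ) ∞ a x₀ →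
      ContMDiffAt 𝓘(ℝ, E) 𝓘(ℝ, E →L[ℝ] E →L[ℝ] ℝ) ∞ (fun x ↦ (a x).smulRight (a x)) x₀ := by
    intro a ha
    have h5 : ContDiff ℝ ∞ fun b : E →L[ℝ] ℝ ↦ b.smulRight b := contDiff_id.smulRight contDiff_id
    exact h5.contMDiff.contMDiffAt.comp x₀ ha
  exact h1.add ((hf x₀).smul ((h4 h2).add (h4 h3)))

variable [FiniteDimensional ℝ E]

/-- Bessel's inequality for `T, JT`, in the form that gives the deformed metric. -/
theorem deformedForm_pos (hg : IsHermitian J g) (hn : ∀ x, θ x (sharp g θ x) = 1)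
    (hf : ∀ x, -1 < f x) (x : M) (v : TangentSpace 𝓘(ℝ, E) x) (hv : v ≠ 0) :
    0 < deformedForm J g θ f x v (J x v) := by
  rw [deformedForm_apply_J hg]
  set T := sharp g θ x with hT
  set a := θ x v with ha
  set b := J.onForm θ x v with hb
  have hTv : g.inner x T v = a := inner_sharp g θ x v
  have hJTv : g.inner x (J x T) v = b := fundamentalForm_sharp hg x v
  have hTT : g.inner x T T = 1 := (inner_sharp g θ x T).trans (hn x)
  have hJTJT : g.inner x (J x T) (J x T) = 1 := (hg x T T).trans hTT
  have hTJT : g.inner x T (J x T) = 0 := by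
    have h1 := hg.inner_left x T T
    rw [g.symm] at h1
    linarith
  have hJTT : g.inner x (J x T) T = 0 := (g.symm x _ _).trans hTJT
  have hvT : g.inner x v T = a := (g.symm x _ _).trans hTv
  have hvJT : g.inner x v (J x T) = b := (g.symm x _ _).trans hJTv
  have key : g.inner x (v - a • T - b • J x T) (v - a • T - b • J x T)
      = g.inner x v v - a ^ 2 - b ^ 2 := by
    simp only [map_sub, sub_apply, map_smul, smul_apply, smul_eq_mul, hTv, hJTv, hTT, hJTJT, hTJT,
      hJTT, hvT, hvJT]
    ring
  have hnn : 0 ≤ g.inner x (v - a • T - b • J x T) (v - a • T - b • J x T) := by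
    by_cases h0 : v - a • T - b • J x T = 0
    · rw [h0]
      simp
    · exact (g.pos x _ h0).le
  have hf' := hf x
  have hvv := g.pos x v hv
  -- `f > -1` gives `f (a² + b²) > -(a² + b²) ≥ -g(v, v)`, strict only when `a² + b²` is positive;
  -- otherwise the correction vanishes and `g(v, v) > 0` suffices.
  by_cases hab : a ^ 2 + b ^ 2 = 0
  · have : a * a + b * b = 0 := by linarith [hab, sq a, sq b]
    rw [this]
    linarith
  · have hpos : 0 < a ^ 2 + b ^ 2 := lt_of_le_of_ne (by positivity) (Ne.symm hab)
    nlinarith [mul_pos (by linarith : 0 < 1 + f x) hpos]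

/-- The metric `g + f (θ ⊗ θ + Jθ ⊗ Jθ)`. -/
def deformedMetric (J : ComplexStructure E M) (g : RMetric E M) (θ : Form1 E M) (f : M → ℝ)
    (hg : IsHermitian J g) (hθ : SmoothForm1 θ) (hn : ∀ x, θ x (sharp g θ x) = 1)
    (hf : ContMDiff 𝓘(ℝ, E) 𝓘(ℝ, ℝ) ∞ f) (hf1 : ∀ x, -1 < f x) : RMetric E M where
  inner x := g.inner x + f x • ((θ x).smulRight (θ x) + (J.onForm θ x).smulRight (J.onForm θ x))
  symm x v w := by
    simp only [add_apply, smul_apply, ContinuousLinearMap.smulRight_apply, smul_eq_mul,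
      g.symm x v w]
    ring
  pos x v hv := by
    have h := deformedForm_pos hg hn hf1 x v hv
    rwa [deformedForm_apply_J hg] at h
  isVonNBounded x := isVonNBounded_of_posDef (E := E) _ fun v hv ↦
    (deformedForm_pos hg hn hf1 x v hv).trans_eq (deformedForm_apply_J hg x v v)
  contMDiff := contMDiff_deformedMetric hθ hf

/-- The central computation: in `d(f θ ∧ Jθ) = df ∧ θ ∧ Jθ + f dθ ∧ Jθ - f θ ∧ d(Jθ)` the first two
terms vanish and the third is `f θ ∧ ω`, as `d(Jθ) = θ ∧ Jθ - ω`. -/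
theorem extDeriv2_deformedForm (h : IsVaismanWith J g θ) (hn : ∀ x, θ x (sharp g θ x) = 1)
    (hf : ContMDiff 𝓘(ℝ, E) 𝓘(ℝ, ℝ) ∞ f) (hw : ∀ x, wedge (diff f) θ x = 0) {x : M}
    {X Y Z : VField E M} (hX : DiffAt X x) (hY : DiffAt Y x) (hZ : DiffAt Z x) :
    extDeriv2 (deformedForm J g θ f) X Y Z x =
      wedge12 (fun x ↦ (1 + f x) • θ x) (deformedForm J g θ f) x (X x) (Y x) (Z x) := by
  have F12 := h.extDeriv1_onForm hn hX hY
  have F13 := h.extDeriv1_onForm hn hX hZ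
  have F23 := h.extDeriv1_onForm hn hY hZ
  have hL := h.1
  have E12 := hL.closed x X Y hX hY
  have E13 := hL.closed x X Z hX hZ
  have E23 := hL.closed x Y Z hY hZ
  have W : ∀ u v, wedge (diff f) θ x u v = 0 := fun u v ↦ by rw [hw]; rfl
  have W12 := W (X x) (Y x)
  have W13 := W (X x) (Z x)
  have W23 := W (Y x) (Z x)
  have L := hL.lee x X Y Z hX hY hZ
  simp only [extDeriv2, diff_deformedForm hL.smooth hf hY hZ,
    diff_deformedForm hL.smooth hf hX hZ,
    diff_deformedForm hL.smooth hf hX hY]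
  simp only [extDeriv2, wedge12] at L
  simp only [extDeriv1, wedge_apply] at F12 F13 F23 E12 E13 E23 W12 W13 W23
  simp only [wedge12, deformedForm_apply, smul_apply, smul_eq_mul]
  -- The groups are `dω = θ ∧ ω`, then `f dθ ∧ Jθ`, `-f θ ∧ d(Jθ)` and `df ∧ θ ∧ Jθ`, each evaluated
  -- on `X, Y, Z`.
  linear_combination L + f x * (E12 * J.onForm θ x (Z x) - E13 * J.onForm θ x (Y x)
    + E23 * J.onForm θ x (X x)) - f x * (F23 * θ x (X x) - F13 * θ x (Y x) + F12 * θ x (Z x))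
    + W12 * J.onForm θ x (Z x) - W13 * J.onForm θ x (Y x) + W23 * J.onForm θ x (X x)

/-- `df ∧ θ = 0` says that the gradient of `f` is collinear to `θ♯`. -/
theorem wedge_diff_eq_zero_iff (hn : ∀ x, θ x (sharp g θ x) = 1) (f : M → ℝ) (x : M) :
    wedge (diff f) θ x = 0 ↔ ∃ c : ℝ, sharp g (diff f) x = c • sharp g θ x := by
  constructor
  · intro h
    -- The factor is found by inserting `T` into `df ∧ θ = 0`: `df = df(T) θ`, as `θ(T) = 1`.
    refine ⟨diff f x (sharp g θ x), ?_⟩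
    rw [sharp_eq_iff]
    intro w
    have h1 : wedge (diff f) θ x (sharp g θ x) w = 0 := by rw [h]; rfl
    rw [wedge_apply, hn] at h1
    rw [map_smul, smul_apply, inner_sharp, smul_eq_mul]
    linarith
  · rintro ⟨c, hc⟩
    have h1 : ∀ w, diff f x w = c * θ x w := by
      intro w
      rw [← inner_sharp g (diff f) x w, hc, map_smul, smul_apply, inner_sharp, smul_eq_mul]
    ext v w
    rw [wedge_apply, h1, h1]
    simp only [zero_apply]
    ring

end Deformation


/-! ### Uniqueness of the Lee form and failure of the Vaisman condition -/

/-- A function on a connected manifold whose differential vanishes is constant. -/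
theorem exists_eq_const_of_diff_eq_zero {E : Type*} [NormedAddCommGroup E] [NormedSpace ℝ E]
    {M : Type*} [TopologicalSpace M] [ChartedSpace E M] [IsManifold 𝓘(ℝ, E) ∞ M] [ConnectedSpace M]
    {f : M → ℝ} (hf : ContMDiff 𝓘(ℝ, E) 𝓘(ℝ, ℝ) ∞ f) (h : ∀ x, diff (E := E) f x = 0) :
    ∃ c : ℝ, ∀ x, f x = c := by
  have hloc : IsLocallyConstant f := by
    rw [IsLocallyConstant.iff_eventually_eq]
    intro x
    obtain ⟨r, hr, hball⟩ := Metric.isOpen_iff.1 (chartAt E x).open_target _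
      (mem_chart_target E x)
    have hd : ∀ z ∈ Metric.ball (chartAt E x x) r,
        HasFDerivAt (f ∘ (chartAt E x).symm) (0 : E →L[ℝ] ℝ) z := by
      intro z hz
      have h1 : MDifferentiableAt 𝓘(ℝ, E) 𝓘(ℝ, E) (chartAt E x).symm z :=
        mdifferentiableAt_atlas_symm (chart_mem_atlas E x) (hball hz)
      have h2 := ((hf ((chartAt E x).symm z)).mdifferentiableAt (by simp)).hasMFDerivAt
      have h3 : mfderiv 𝓘(ℝ, E) 𝓘(ℝ, ℝ) f ((chartAt E x).symm z) = 0 := h _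
      rw [h3] at h2
      have h4 := (h2.comp z h1.hasMFDerivAt)
      rw [ContinuousLinearMap.zero_comp] at h4
      exact h4.hasFDerivAt
    have hev : ∀ᶠ y in 𝓝 x, y ∈ (chartAt E x).source ∧
        chartAt E x y ∈ Metric.ball (chartAt E x x) r :=
      Filter.Eventually.and ((chartAt E x).open_source.mem_nhds (mem_chart_source E x))
        (((chartAt E x).continuousAt (mem_chart_source E x)).eventually_mem
          (Metric.ball_mem_nhds _ hr))
    filter_upwards [hev] with y hy
    have h5 := (convex_ball (chartAt E x x) r).is_const_of_fderivWithin_eq_zero (𝕜 := ℝ)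
      (f := f ∘ (chartAt E x).symm)
      (fun z hz ↦ (hd z hz).differentiableAt.differentiableWithinAt)
      (fun z hz ↦ ((hd z hz).hasFDerivWithinAt).fderivWithin
        (Metric.isOpen_ball.uniqueDiffWithinAt hz)) hy.2 (Metric.mem_ball_self hr)
    simpa [(chartAt E x).left_inv hy.1] using h5
  obtain ⟨x₀⟩ := (inferInstance : Nonempty M)
  exact ⟨f x₀, fun x ↦ hloc.apply_eq_of_preconnectedSpace x x₀⟩

section

variable {E : Type*} [NormedAddCommGroup E] [NormedSpace ℝ E] [FiniteDimensional ℝ E]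
  {M : Type*} [TopologicalSpace M] [ChartedSpace E M] [IsManifold 𝓘(ℝ, E) ∞ M]
  {J : ComplexStructure E M} {g : RMetric E M} {θ θ' : Form1 E M} {f : M → ℝ}

/-- In real dimension at least three, a `1`-form `α` with `α ∧ ω = 0` vanishes. -/
theorem eq_zero_of_wedge12_eq_zero (hdim : 3 ≤ Module.finrank ℝ E) (hg : IsHermitian J g)
    (α : Form1 E M) (x : M)
    (h : ∀ u v w, wedge12 α (fundamentalForm J g) x u v w = 0) : α x = 0 := by
  ext u
  have : FiniteDimensional ℝ (TangentSpace 𝓘(ℝ, E) x) := inferInstanceAs (FiniteDimensional ℝ E)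
  -- A nonzero `v` orthogonal to `u` and `Ju` exists because `L` has values in a plane. For it, `(α
  -- ∧ ω)(u, v, Jv) = α(u) g(v, v)`.
  let L : TangentSpace 𝓘(ℝ, E) x →ₗ[ℝ] ℝ × ℝ :=
    (g.inner x u).toLinearMap.prod (g.inner x (J x u)).toLinearMap
  have hker : L.ker ≠ ⊥ := by
    intro hbot
    have h1 := LinearMap.finrank_le_finrank_of_injective (LinearMap.ker_eq_bot.1 hbot)
    have h2 : Module.finrank ℝ (TangentSpace 𝓘(ℝ, E) x) = Module.finrank ℝ E := rfl
    rw [h2, Module.finrank_prod, Module.finrank_self] at h1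
    omega
  obtain ⟨v, hv, hv0⟩ := Submodule.exists_mem_ne_zero_of_ne_bot hker
  have hv1 : g.inner x u v = 0 := congrArg Prod.fst hv
  have hv2 : g.inner x (J x u) v = 0 := congrArg Prod.snd hv
  have h1 := h u v (J x v)
  rw [wedge12, fundamentalForm_apply, fundamentalForm_apply, fundamentalForm_apply, hg, hg, hv1,
    hv2] at h1
  have h2 := (g.pos x v hv0).ne'
  simpa [h2] using h1

/-- `(θ - θ') ∧ ω = 0`. As `IsVaisman` allows any Lee form, this is what reduces its negation to the
single form `(1 + f) θ`. -/
theorem IsLCKWith.lee_unique (hdim : 3 ≤ Module.finrank ℝ E) (h : IsLCKWith J g θ)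
    (h' : IsLCKWith J g θ') : θ = θ' := by
  funext x
  rw [← sub_eq_zero]
  refine eq_zero_of_wedge12_eq_zero hdim h.hermitian (fun y ↦ θ y - θ' y) x fun u v w ↦ ?_
  obtain ⟨X, hX, rfl⟩ := exists_diffAt_eq x u
  obtain ⟨Y, hY, rfl⟩ := exists_diffAt_eq x v
  obtain ⟨Z, hZ, rfl⟩ := exists_diffAt_eq x w
  have h1 := h.lee x X Y Z hX hY hZ
  rw [h'.lee x X Y Z hX hY hZ] at h1
  simp only [wedge12, sub_apply] at h1 ⊢
  linarith

/-- The norm of a parallel form is constant. -/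
theorem IsParallel.diff_apply_sharp (h : IsParallel g θ) (hθ : SmoothForm1 θ) (x : M) :
    diff (E := E) (fun y ↦ θ y (sharp g θ y)) x = 0 := by
  obtain ⟨D, hD, hp⟩ := h
  ext v
  have h1 := hp x v _ ((smoothVField_sharp g hθ).diffAt x)
  rw [cov_sharp_eq_zero hD hθ hp, map_zero, sub_zero] at h1
  exact h1

theorem apply_sharp_of_fnorm_eq_one (hθ : ∀ x, fnorm g θ x = 1) (x : M) :
    θ x (sharp g θ x) = 1 := by
  have h1 := hθ x
  rw [fnorm, vnorm, Real.sqrt_eq_one, inner_sharp] at h1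
  exact h1

theorem exists_deformation (hdim : 3 ≤ Module.finrank ℝ E) (hV : IsVaismanWith J g θ)
    (hθ : ∀ x, fnorm g θ x = 1) (hf : IsAdmissible θ f) :
    ∃ gbar : RMetric E M,
      (∀ (x : M) (v w : TangentSpace 𝓘(ℝ, E) x),
        gbar.inner x v w = deformedForm J g θ f x v (J x w)) ∧
      fundamentalForm J gbar = deformedForm J g θ f ∧
      IsLCKWith J gbar (fun x ↦ (1 + f x) • θ x) ∧
      sharp gbar (fun x ↦ (1 + f x) • θ x) = sharp g θ ∧
      IsHolomorphic J (sharp g θ) ∧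
      (∀ x, gbar.inner x (sharp g θ x) (sharp g θ x) = 1 + f x) ∧
      (¬ ∃ c : ℝ, ∀ x, vnorm gbar (sharp g θ) x = c) ∧
      (ConnectedSpace M → ¬ IsVaisman J gbar) := by
  have hn := apply_sharp_of_fnorm_eq_one hθ
  have hg := hV.1.hermitian
  have hs := hV.1.smooth
  let gbar := deformedMetric J g θ f hg hs hn hf.smooth hf.gt_neg_one
  have hgbar' : ∀ (x : M) (v w : TangentSpace 𝓘(ℝ, E) x), gbar.inner x v w = g.inner x v w
      + f x * (θ x v * θ x w + J.onForm θ x v * J.onForm θ x w) := fun _ _ _ ↦ rfl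
  have hgbar : ∀ (x : M) (v w : TangentSpace 𝓘(ℝ, E) x),
      gbar.inner x v w = deformedForm J g θ f x v (J x w) := fun x v w ↦
    (hgbar' x v w).trans (deformedForm_apply_J hg x v w).symm
  have hherm : IsHermitian J gbar := by
    intro x v w
    rw [hgbar', hgbar', hg, onForm_apply, onForm_apply, onForm_apply, onForm_apply, J.sq, J.sq,
      map_neg, map_neg]
    ring
  have hfund : fundamentalForm J gbar = deformedForm J g θ f := by
    funext x
    ext v w
    rw [fundamentalForm_apply, hherm.inner_left, hgbar, J.sq, map_neg, neg_neg]
  have hLCK : IsLCKWith J gbar (fun x ↦ (1 + f x) • θ x) := by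
    refine ⟨hherm, smoothForm1_smul (contMDiff_const.add hf.smooth) hs,
      hV.1.closed.smul_of_wedge_eq_zero hs hf.smooth hf.wedge_eq_zero, fun x X Y Z hX hY hZ ↦ ?_⟩
    rw [hfund]
    exact extDeriv2_deformedForm hV hn hf.smooth hf.wedge_eq_zero hX hY hZ
  have hJT : ∀ x, θ x (J x (sharp g θ x)) = 0 := by
    intro x
    have h1 := hg.inner_left x (sharp g θ x) (sharp g θ x)
    rw [g.symm, inner_sharp] at h1
    linarith
  have hsharp : sharp gbar (fun x ↦ (1 + f x) • θ x) = sharp g θ := by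
    funext x
    rw [sharp_eq_iff]
    intro w
    rw [hgbar', inner_sharp, hn, onForm_apply, hJT, smul_apply, smul_eq_mul]
    ring
  have hnorm : ∀ x, gbar.inner x (sharp g θ x) (sharp g θ x) = 1 + f x := by
    intro x
    rw [hgbar', inner_sharp, hn, onForm_apply, hJT]
    ring
  refine ⟨gbar, hgbar, hfund, hLCK, hsharp, hV.isHolomorphic_sharp, hnorm, ?_, ?_⟩
  · rintro ⟨c, hc⟩
    -- From `|T|² = 1 + f` in the deformed metric.
    refine hf.nonconst ⟨c ^ 2 - 1, fun x ↦ ?_⟩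
    have h1 := hf.gt_neg_one x
    rw [← hc x, vnorm, hnorm, Real.sq_sqrt (by linarith)]
    ring
  · rintro hconn ⟨θ', hL', hp⟩
    obtain rfl := hLCK.lee_unique hdim hL'
    -- The squared norm of the Lee form of `gbar` is `(1 + f) θ(T) = 1 + f`; were the form parallel,
    -- the differential of `1 + f` would vanish.
    have h1 := IsParallel.diff_apply_sharp hp hLCK.smooth
    simp only [hsharp, smul_apply, hn, smul_eq_mul, mul_one] at h1
    obtain ⟨c, hc⟩ := exists_eq_const_of_diff_eq_zero (contMDiff_const.add hf.smooth) h1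
    exact hf.nonconst ⟨c - 1, fun x ↦ by
      have h2 : 1 + f x = c := hc x
      linarith⟩

end


/-! ### Differentials and Lie brackets in a chart -/

section Chart

variable {E : Type*} [NormedAddCommGroup E] {M : Type*} [TopologicalSpace M] [ChartedSpace E M]

theorem eventually_chart_target (x : M) : ∀ᶠ z in 𝓝 (chartAt E x x), z ∈ (chartAt E x).target :=
  (chartAt E x).open_target.mem_nhds (mem_chart_target E x)

theorem eventually_chart_source (x : M) : ∀ᶠ y in 𝓝 x, y ∈ (chartAt E x).source :=
  (chartAt E x).open_source.mem_nhds (mem_chart_source E x)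

variable [NormedSpace ℝ E] {x : M} {f : M → ℝ}

theorem diff_eq_fderiv (hf : MDifferentiableAt 𝓘(ℝ, E) 𝓘(ℝ, ℝ) f x) (v : E) :
    diff (E := E) f x v = fderiv ℝ (fun z ↦ f ((chartAt E x).symm z)) (chartAt E x x) v := by
  have h := hf.mvfderiv
  rw [diff, h]
  simp only [mfld_simps, fderivWithin_univ]
  rfl

end Chart

section Hat

variable {E : Type*} [NormedAddCommGroup E] [NormedSpace ℝ E]
  {M : Type*} [TopologicalSpace M] [ChartedSpace E M] [IsManifold 𝓘(ℝ, E) ∞ M]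
  {x : M} {X Y : VField E M}

/-- The vector field `X` read in the chart at `x`. -/
def hat (x : M) (X : VField E M) (z : E) : E :=
  coframe x ((chartAt E x).symm z) (X ((chartAt E x).symm z))

theorem coframe_self (x : M) (v : TangentSpace 𝓘(ℝ, E) x) : coframe x x v = v := by
  rw [coframe, TangentBundle.continuousLinearMapAt_trivializationAt (mem_chart_source E x),
    mfderiv_extChartAt_self]
  rfl

theorem hat_self (x : M) (X : VField E M) : hat x X (chartAt E x x) = X x := by
  rw [hat, (chartAt E x).left_inv (mem_chart_source E x), coframe_self]

theorem mdifferentiableAt_chart_symm (x : M) :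
    MDifferentiableAt 𝓘(ℝ, E) 𝓘(ℝ, E) (chartAt E x).symm (chartAt E x x) :=
  mdifferentiableAt_atlas_symm (chart_mem_atlas E x) (mem_chart_target E x)

theorem differentiableAt_comp_chart_symm {F : Type*} [NormedAddCommGroup F] [NormedSpace ℝ F]
    {f : M → F} (hf : MDifferentiableAt 𝓘(ℝ, E) 𝓘(ℝ, F) f x) :
    DifferentiableAt ℝ (fun z ↦ f ((chartAt E x).symm z)) (chartAt E x x) := by
  rw [← (chartAt E x).left_inv (mem_chart_source E x)] at hf
  exact (hf.comp _ (mdifferentiableAt_chart_symm x)).differentiableAt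

theorem DiffAt.differentiableAt_hat (hX : DiffAt X x) :
    DifferentiableAt ℝ (hat x X) (chartAt E x x) := by
  have h := (mdifferentiableAt_section (F := E) (E := TangentSpace 𝓘(ℝ, E)) 𝓘(ℝ, E) X).1 hX
  have h2 : MDifferentiableAt 𝓘(ℝ, E) 𝓘(ℝ, E) (fun y ↦ coframe x y (X y)) x := by
    refine h.congr_of_eventuallyEq ?_
    filter_upwards [eventually_chart_source (E := E) x] with y hy
    rw [Trivialization.continuousLinearMapAt_apply, Trivialization.coe_linearMapAt_of_mem _ hy]
  exact differentiableAt_comp_chart_symm h2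

/-- The manifold bracket is the flat bracket of the fields pulled back by the inverse chart, and
these pullbacks are `hat x X`. At the centre of its own chart the differential of the chart is the
identity, so no transport back is needed. -/
theorem bracket_eq (X Y : VField E M) (x : M) :
    bracket X Y x = fderiv ℝ (hat x Y) (chartAt E x x) (X x)
      - fderiv ℝ (hat x X) (chartAt E x x) (Y x) := by
  have hev : ∀ X : VField E M, VectorField.mpullbackWithin 𝓘(ℝ, E) 𝓘(ℝ, E)
      (extChartAt 𝓘(ℝ, E) x).symm X (Set.range 𝓘(ℝ, E)) =ᶠ[𝓝 (chartAt E x x)] hat x X := by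
    intro X
    filter_upwards [eventually_chart_target x] with z hz
    have h1 : (chartAt E x).symm z ∈ (chartAt E x).source := (chartAt E x).map_target hz
    have h2 := TangentBundle.symmL_trivializationAt (I := 𝓘(ℝ, E)) h1
    have h3 : extChartAt 𝓘(ℝ, E) x ((chartAt E x).symm z) = z := by
      simp [(chartAt E x).right_inv hz]
    rw [h3] at h2
    rw [VectorField.mpullbackWithin_apply, ← h2]
    have h4 : coframe x ((chartAt E x).symm z) = (frame x ((chartAt E x).symm z)).inverse :=
      (ContinuousLinearMap.inverse_eq (by ext v; exact frame_coframe h1 v)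
        (by ext v; exact coframe_frame h1 v)).symm
    rw [hat, h4]
    rfl
  have h := VectorField.mlieBracketWithin_apply (I := 𝓘(ℝ, E)) (V := X) (W := Y) (s := Set.univ)
    (x₀ := x)
  have hset : (extChartAt 𝓘(ℝ, E) x).symm ⁻¹' Set.univ ∩ Set.range 𝓘(ℝ, E) = Set.univ := by simp
  rw [mfderiv_extChartAt_self, hset] at h
  refine h.trans ?_
  refine Eq.trans (b := VectorField.lieBracket ℝ (hat x X) (hat x Y) (chartAt E x x)) ?_ ?_
  · refine (DFunLike.congr_fun (ContinuousLinearMap.inverse_id (R := ℝ) (M := E)) _).trans ?_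
    refine (congrFun (VectorField.lieBracketWithin_univ (𝕜 := ℝ) (E := E)) _).trans ?_
    exact (hev X).lieBracket_vectorField_eq (hev Y)
  · rw [VectorField.lieBracket, hat_self, hat_self]

end Hat


/-! ### Charts of the Hopf manifold -/

section HopfCharts

variable {n : ℕ} {a : ℝ} [ha : Fact (1 < a)]

theorem hopfProj_surjective : Function.Surjective (hopfProj a : punctured n → Hopf n a) :=
  Quotient.mk_surjective

theorem continuous_hopfProj : Continuous (hopfProj a : punctured n → Hopf n a) :=
  continuous_quotient_mk'

theorem hopfProj_smul (k : Dilations a) (x : punctured n) :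
    hopfProj a (k • x) = hopfProj a x := hopfProj_eq_iff.2 ⟨k, rfl⟩

/-- A chart is a local inverse `s` of the projection followed by the inclusion into `ℂⁿ`; hence `0`
is never a coordinate. -/
theorem exists_chart_lift (q : Hopf n a) :
    ∃ s : OpenPartialHomeomorph (Hopf n a) (punctured n),
      s.source = (chartAt (Cn n) q).source ∧ (∀ z, s.symm z = hopfProj a z) ∧
      (∀ p, chartAt (Cn n) q p = (s p : Cn n)) ∧
      (∀ z ∈ (chartAt (Cn n) q).target, z ≠ 0) := by
  have : ∀ e ∈ atlas (Cn n) (Hopf n a), ∃ s : OpenPartialHomeomorph (Hopf n a) (punctured n),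
      s.source = e.source ∧ (∀ z, s.symm z = hopfProj a z) ∧ (∀ p, e p = (s p : Cn n)) := by
    rintro e ⟨q, rfl⟩
    refine ⟨hopf_isLocalHomeomorph.localInverseAt _, ?_, fun z ↦ ?_, fun q' ↦ rfl⟩
    · ext z
      simp only [TopologicalSpace.Opens.chartAt_eq, OpenPartialHomeomorph.trans_source,
        OpenPartialHomeomorph.subtypeRestr_source, chartAt_self_eq,
        OpenPartialHomeomorph.refl_source, Set.preimage_univ, Set.inter_univ]
      rfl
    · rw [IsLocalHomeomorph.localInverseAt_symm]
  obtain ⟨s, h1, h2, h3⟩ := this _ (chart_mem_atlas (Cn n) q)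
  refine ⟨s, h1, h2, h3, fun z hz ↦ ?_⟩
  rw [← (chartAt (Cn n) q).right_inv hz, h3]
  exact punctured_ne_zero _

theorem chart_target_ne_zero {q : Hopf n a} {z : Cn n} (hz : z ∈ (chartAt (Cn n) q).target) :
    z ≠ 0 := by
  obtain ⟨s, -, -, -, h⟩ := exists_chart_lift q
  exact h z hz

theorem chart_symm_eq {q : Hopf n a} {z : Cn n} (hz : z ∈ (chartAt (Cn n) q).target) :
    (chartAt (Cn n) q).symm z = hopfProj a ⟨z, chart_target_ne_zero hz⟩ := by
  obtain ⟨s, h1, h2, h3, -⟩ := exists_chart_lift q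
  have h5 := (chartAt (Cn n) q).map_target hz
  rw [← h1] at h5
  have h6 := s.left_inv h5
  rw [h2] at h6
  rw [← h6]
  congr 1
  refine Subtype.ext ?_
  rw [← h3, (chartAt (Cn n) q).right_inv hz]

/-- Near `x`, the projection followed by a chart is a dilation. -/
theorem exists_chart_proj_eq {q : Hopf n a} {x : punctured n}
    (hx : hopfProj a x ∈ (chartAt (Cn n) q).source) :
    ∃ c : ℝ, 0 < c ∧ (∃ k : ℤ, c = a ^ k) ∧
      ∀ᶠ y in 𝓝 x, hopfProj a y ∈ (chartAt (Cn n) q).source ∧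
        chartAt (Cn n) q (hopfProj a y) = c • (y : Cn n) := by
  obtain ⟨s, h1, h2, h3, -⟩ := exists_chart_lift q
  obtain ⟨k, hk⟩ : ∃ k : Dilations a, k • x = s (hopfProj a x) := by
    apply hopfProj_eq_iff.1
    rw [← h2, s.left_inv (h1 ▸ hx)]
  refine ⟨a ^ k.exponent, dilation_pos _, ⟨_, rfl⟩, ?_⟩
  -- The same `k` works near `x`: as long as `k • y` stays in the target of `s`, it is the value of
  -- `s` at the class of `y`.
  have hev : ∀ᶠ y in 𝓝 x, k • y ∈ s.target :=
    (continuous_const_smul k).continuousAt.eventually_mem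
      (s.open_target.mem_nhds (hk ▸ s.map_source (h1 ▸ hx)))
  filter_upwards [hev] with y hy
  have h5 : s.symm (k • y) = hopfProj a y := by rw [h2, hopfProj_smul]
  have h6 := s.map_target hy
  have h7 := s.right_inv hy
  rw [h5] at h6 h7
  exact ⟨h1 ▸ h6, by rw [h3, h7, coe_dilation_smul]⟩

/-- Near a point of the intersection of two chart domains, the coordinate change is a dilation. -/
theorem exists_chart_chart_eq {q q' : Hopf n a} {p : Hopf n a}
    (hp : p ∈ (chartAt (Cn n) q).source) (hp' : p ∈ (chartAt (Cn n) q').source) :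
    ∃ c : ℝ, 0 < c ∧ ∀ᶠ z in 𝓝 (chartAt (Cn n) q p),
      chartAt (Cn n) q' ((chartAt (Cn n) q).symm z) = c • z := by
  have ht := (chartAt (Cn n) q).map_source hp
  have hx := chart_symm_eq ht
  rw [(chartAt (Cn n) q).left_inv hp] at hx
  rw [hx] at hp'
  obtain ⟨c, hc, -, hev⟩ := exists_chart_proj_eq hp'
  refine ⟨c, hc, ?_⟩
  have hev' := (punctured n).isOpen.isOpenEmbedding_subtypeVal.map_nhds_eq
    ⟨_, chart_target_ne_zero ht⟩
  have hev2 : ∀ᶠ z in 𝓝 (chartAt (Cn n) q p), ∃ y : punctured n, (y : Cn n) = z ∧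
      chartAt (Cn n) q' (hopfProj a y) = c • (y : Cn n) := by
    rw [← hev']
    exact Filter.eventually_map.2 (hev.mono fun y hy ↦ ⟨y, rfl, hy.2⟩)
  filter_upwards [hev2, (chartAt (Cn n) q).open_target.mem_nhds ht] with z hz hzt
  obtain ⟨y, rfl, hy⟩ := hz
  rw [chart_symm_eq hzt, hy]

/-- The coordinates of `q` in the chart at `q`. -/
def pt (q : Hopf n a) : Cn n := chartAt (Cn n) q q

theorem pt_ne_zero (q : Hopf n a) : pt q ≠ 0 := chart_target_ne_zero (mem_chart_target _ q)

/-- The tangent vectors at a point are scaled by a positive factor under a change of charts, and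
the coordinates of the point are scaled by the same factor. -/
theorem exists_frame_eq {q p : Hopf n a} (hp : p ∈ (chartAt (Cn n) q).source) :
    ∃ c : ℝ, 0 < c ∧ pt p = c • chartAt (Cn n) q p ∧ ∀ v : Cn n, frame q p v = (c • v : Cn n) := by
  obtain ⟨c, hc, hev⟩ := exists_chart_chart_eq hp (mem_chart_source (Cn n) p)
  refine ⟨c, hc, ?_, fun v ↦ ?_⟩
  · have h := hev.self_of_nhds
    rwa [(chartAt (Cn n) q).left_inv hp] at h
  · rw [frame, TangentBundle.symmL_trivializationAt_eq_core hp,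
      tangentBundleCore_coordChange_achart]
    have h1 : HasFDerivAt (fun z : Cn n ↦ c • z) (c • ContinuousLinearMap.id ℝ (Cn n))
        (chartAt (Cn n) q p) := (hasFDerivAt_id _).const_smul c
    have h2 := (h1.congr_of_eventuallyEq hev).fderiv
    simp only [mfld_simps, fderivWithin_univ]
    exact DFunLike.congr_fun h2 v

/-- One constant `c` scales both the base point and tangent vectors, so it cancels in
dilation-invariant expressions. -/
theorem hasMFDerivAt_hopfProj (x : punctured n) :
    ∃ c : ℝ, 0 < c ∧ pt (hopfProj a x) = c • (x : Cn n) ∧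
      HasMFDerivAt 𝓘(ℝ, Cn n) 𝓘(ℝ, Cn n) (hopfProj a) x
        (c • ContinuousLinearMap.id ℝ (Cn n)) := by
  obtain ⟨c, hc, -, hev⟩ := exists_chart_proj_eq (mem_chart_source (Cn n) (hopfProj a x))
  refine ⟨c, hc, hev.self_of_nhds.2, continuous_hopfProj.continuousAt, ?_⟩
  have h1 : HasFDerivAt (fun z : Cn n ↦ c • z) (c • ContinuousLinearMap.id ℝ (Cn n))
      (x : Cn n) := (hasFDerivAt_id _).const_smul c
  have hev' := (punctured n).isOpen.isOpenEmbedding_subtypeVal.map_nhds_eq x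
  have hx : ∀ᶠ z in 𝓝 (x : Cn n), z ∈ (chartAt (Cn n) x).target := by
    exact (chartAt (Cn n) x).open_target.mem_nhds (mem_chart_target (Cn n) x)
  refine (h1.congr_of_eventuallyEq ?_).hasFDerivWithinAt
  have hev2 : ∀ᶠ z in 𝓝 (x : Cn n), ∃ y : punctured n, (y : Cn n) = z ∧
      chartAt (Cn n) (hopfProj a x) (hopfProj a y) = c • (y : Cn n) := by
    rw [← hev']
    exact Filter.eventually_map.2 (hev.mono fun y hy ↦ ⟨y, rfl, hy.2⟩)
  filter_upwards [hev2, hx] with z hz hzt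
  obtain ⟨y, rfl, hy⟩ := hz
  have h2 : (chartAt (Cn n) x).symm (y : Cn n) = y :=
    Subtype.ext ((chartAt (Cn n) x).right_inv hzt)
  rw [← hy]
  change chartAt (Cn n) (hopfProj a x) (hopfProj a ((chartAt (Cn n) x).symm (y : Cn n))) = _
  rw [h2]

end HopfCharts


/-! ### Linear algebra and conformal calculus on `ℂⁿ` -/

section FlatCalculus

theorem contDiffAt_smul_vector {E F : Type*} [NormedAddCommGroup E] [NormedSpace ℝ E]
    [NormedAddCommGroup F] [NormedSpace ℝ F] {φ : E → ℝ} {z : E} (hφ : ContDiffAt ℝ ∞ φ z) (v : F) :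
    ContDiffAt ℝ ∞ (fun z ↦ φ z • v) z := hφ.smul contDiffAt_const

variable {n : ℕ}

/-- Multiplication by `i` as a real linear map. -/
def mulI (n : ℕ) : Cn n →L[ℝ] Cn n :=
  (Complex.I • ContinuousLinearMap.id ℂ (Cn n)).restrictScalars ℝ

theorem mulI_apply (v : Cn n) : mulI n v = Complex.I • v := rfl

theorem mulI_mulI (v : Cn n) : mulI n (mulI n v) = -v := by
  rw [mulI_apply, mulI_apply, smul_smul, Complex.I_mul_I, neg_one_smul]

theorem inner_mulI_mulI (v w : Cn n) : inner ℝ (mulI n v) (mulI n w) = inner ℝ v w := by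
  simp only [mulI_apply, PiLp.inner_apply, PiLp.smul_apply, Complex.inner, smul_eq_mul, map_mul,
    Complex.conj_I]
  refine Finset.sum_congr rfl fun i _ ↦ ?_
  congr 1
  linear_combination (-(starRingEnd ℂ) (v i) * w i) * Complex.I_mul_I

theorem inner_mulI_left (v w : Cn n) : inner ℝ (mulI n v) w = -inner ℝ v (mulI n w) := by
  have h := inner_mulI_mulI v (mulI n w)
  rw [mulI_mulI, inner_neg_right] at h
  rw [← h, neg_neg]

variable (n) in
/-- The real inner product of `ℂⁿ` as a bilinear map. -/
def cnInner : Cn n →L[ℝ] Cn n →L[ℝ] ℝ := innerSL ℝ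

theorem cnInner_apply (v w : Cn n) : cnInner n v w = inner ℝ v w := rfl

theorem contDiffAt_conformal_factor {z : Cn n} (hz : z ≠ 0) :
    ContDiffAt ℝ ∞ (fun z : Cn n ↦ 4 / ‖z‖ ^ 2) z :=
  contDiffAt_const.div (contDiff_norm_sq ℝ).contDiffAt (pow_ne_zero 2 (norm_ne_zero_iff.2 hz))

/-- The derivative of `z ↦ 4 |z|⁻² ⟨V z, W z⟩`. -/
theorem fderiv_conformal_inner {V W : Cn n → Cn n} {z : Cn n} (hz : z ≠ 0)
    (hV : DifferentiableAt ℝ V z) (hW : DifferentiableAt ℝ W z) (v : Cn n) :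
    fderiv ℝ (fun z ↦ 4 / ‖z‖ ^ 2 * inner ℝ (V z) (W z)) z v =
      4 / ‖z‖ ^ 2 * (inner ℝ (fderiv ℝ V z v) (W z) + inner ℝ (V z) (fderiv ℝ W z v))
        - 8 * inner ℝ z v / ‖z‖ ^ 4 * inner ℝ (V z) (W z) := by
  have hz2 : ‖z‖ ^ 2 ≠ 0 := pow_ne_zero 2 (norm_ne_zero_iff.2 hz)
  have h1 : HasFDerivAt (fun z : Cn n ↦ ‖z‖ ^ 2) (2 • innerSL ℝ z) z :=
    (hasStrictFDerivAt_norm_sq z).hasFDerivAt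
  have h2 : HasFDerivAt (fun z : Cn n ↦ 4 * (‖z‖ ^ 2)⁻¹)
      ((4 : ℝ) • (-((‖z‖ ^ 2) ^ 2)⁻¹ • (2 • innerSL ℝ z))) z :=
    ((hasDerivAt_inv hz2).comp_hasFDerivAt z h1).const_mul 4
  have h3 : HasFDerivAt (fun z ↦ 4 / ‖z‖ ^ 2 * inner ℝ (V z) (W z)) _ z :=
    h2.mul (hV.hasFDerivAt.inner ℝ hW.hasFDerivAt)
  rw [h3.fderiv]
  simp only [add_apply, smul_apply, smul_eq_mul, ContinuousLinearMap.comp_apply,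
    ContinuousLinearMap.prod_apply, fderivInnerCLM_apply, innerSL_apply_apply, nsmul_eq_mul]
  push_cast
  field_simp
  ring

end FlatCalculus

/-! ### Complex structure, metric and Lee form of the Hopf manifold -/

section HopfTensors

variable {n : ℕ} {a : ℝ} [ha : Fact (1 < a)]

/-- The frame of the Hopf manifold, read in `ℂⁿ`. -/
def fr (q p : Hopf n a) : Cn n →L[ℝ] Cn n := frame q p

/-- The coframe of the Hopf manifold, read in `ℂⁿ`. -/
def cofr (q p : Hopf n a) : Cn n →L[ℝ] Cn n := coframe q p

theorem fr_cofr {q p : Hopf n a} (hp : p ∈ (chartAt (Cn n) q).source) (v : Cn n) :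
    fr q p (cofr q p v) = v := frame_coframe hp v

theorem cofr_fr {q p : Hopf n a} (hp : p ∈ (chartAt (Cn n) q).source) (v : Cn n) :
    cofr q p (fr q p v) = v := coframe_frame hp v

theorem exists_fr_eq {q p : Hopf n a} (hp : p ∈ (chartAt (Cn n) q).source) :
    ∃ c : ℝ, 0 < c ∧ pt p = c • chartAt (Cn n) q p ∧ ∀ v : Cn n, fr q p v = c • v :=
  exists_frame_eq hp

theorem mulI_fr {q p : Hopf n a} (hp : p ∈ (chartAt (Cn n) q).source) (v : Cn n) :
    mulI n (fr q p v) = fr q p (mulI n v) := by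
  obtain ⟨c, -, -, h⟩ := exists_fr_eq hp
  rw [h, h, map_smul]

theorem cofr_mulI {q p : Hopf n a} (hp : p ∈ (chartAt (Cn n) q).source) (v : Cn n) :
    cofr q p (mulI n v) = mulI n (cofr q p v) := by
  rw [← cofr_fr hp (mulI n (cofr q p v)), ← mulI_fr hp, fr_cofr hp]

variable (n a) in
/-- The field of endomorphisms of the Hopf manifold induced by multiplication by `i`. -/
def hopfEnd : EndField (Cn n) (Hopf n a) := fun _ ↦ mulI n

theorem hat_hopfEnd (q : Hopf n a) (X : VField (Cn n) (Hopf n a)) :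
    hat q (fun p ↦ hopfEnd n a p (X p)) =ᶠ[𝓝 (pt q)] fun z ↦ mulI n (hat q X z) := by
  filter_upwards [eventually_chart_target q] with z hz
  exact cofr_mulI ((chartAt (Cn n) q).map_target hz) _

/-- `J` has constant coefficients in the charts, since dilations commute with `i`. -/
theorem fderiv_hat_hopfEnd {q : Hopf n a} {X : VField (Cn n) (Hopf n a)} (hX : DiffAt X q)
    (v : Cn n) : fderiv ℝ (hat q (fun p ↦ hopfEnd n a p (X p))) (pt q) v =
      mulI n (fderiv ℝ (hat q X) (pt q) v) := by
  rw [(hat_hopfEnd q X).fderiv_eq]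
  exact DFunLike.congr_fun ((mulI n).hasFDerivAt.comp (pt q)
    hX.differentiableAt_hat.hasFDerivAt).fderiv v

variable (n a) in
/-- The complex structure of the Hopf manifold. -/
def hopfJ : ComplexStructure (Cn n) (Hopf n a) where
  toFun := hopfEnd n a
  smooth := by
    refine smoothEnd_iff.2 fun q ↦ ?_
    refine (contMDiffAt_const (c := mulI n)).congr_of_eventuallyEq ?_
    filter_upwards [eventually_chart_source (E := Cn n) q] with p hp
    refine ContinuousLinearMap.ext fun v ↦ ?_
    change cofr q p (mulI n (fr q p v)) = mulI n v
    rw [cofr_mulI hp, cofr_fr hp]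
  sq _ v := mulI_mulI v
  nijenhuis q X Y hX hY := by
    have hXJ := fderiv_hat_hopfEnd hX
    have hYJ := fderiv_hat_hopfEnd hY
    simp only [bracket_eq]
    set A : Cn n →L[ℝ] Cn n := fderiv ℝ (hat q X) (pt q)
    set B : Cn n →L[ℝ] Cn n := fderiv ℝ (hat q Y) (pt q)
    set A' : Cn n →L[ℝ] Cn n := fderiv ℝ (hat q (fun p ↦ hopfEnd n a p (X p))) (pt q)
    set B' : Cn n →L[ℝ] Cn n := fderiv ℝ (hat q (fun p ↦ hopfEnd n a p (Y p))) (pt q)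
    -- With `A' = iA` and `B' = iB` the tensor cancels algebraically. The vectors `u, v` stand for
    -- `X q, Y q`, so that the identity lives in `ℂⁿ` rather than in a tangent space.
    have key : ∀ u v : Cn n, B' (mulI n u) - A' (mulI n v) - mulI n (B (mulI n u) - A' v)
        - mulI n (B' u - A (mulI n v)) - (B u - A v) = 0 := by
      intro u v
      simp only [hXJ, hYJ, map_sub, mulI_mulI]
      abel
    exact key (X q) (Y q)

theorem contMDiffAt_chart (q : Hopf n a) :
    ContMDiffAt 𝓘(ℝ, Cn n) 𝓘(ℝ, Cn n) ∞ (chartAt (Cn n) q) q :=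
  contMDiffAt_extChartAt (I := 𝓘(ℝ, Cn n))

/-- The frame multiplies vectors and base point by the same `c`, and `4 |c z|⁻² c² = 4 |z|⁻²`: the
metric has one formula in all charts. -/
theorem conformal_inner_fr {q p : Hopf n a} (hp : p ∈ (chartAt (Cn n) q).source) (v w : Cn n) :
    4 / ‖pt p‖ ^ 2 * inner ℝ (fr q p v) (fr q p w) =
      4 / ‖chartAt (Cn n) q p‖ ^ 2 * inner ℝ v w := by
  obtain ⟨c, hc, h1, h⟩ := exists_fr_eq hp
  have h0 : ‖chartAt (Cn n) q p‖ ≠ 0 :=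
    norm_ne_zero_iff.2 (chart_target_ne_zero ((chartAt (Cn n) q).map_source hp))
  rw [h, h, h1, norm_smul, real_inner_smul_left, real_inner_smul_right, Real.norm_of_nonneg hc.le]
  field_simp

theorem conformal_inner_pos (q : Hopf n a) {v : Cn n} (hv : v ≠ 0) :
    0 < 4 / ‖pt q‖ ^ 2 * inner ℝ v v := by
  have h1 : 0 < ‖pt q‖ := norm_pos_iff.2 (pt_ne_zero q)
  have h2 : 0 < inner ℝ v v := real_inner_self_pos.2 hv
  positivity

variable (n a) in
/-- The metric of the Hopf manifold that is induced by `4 r⁻² g_{ℂⁿ}`. -/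
def hopfMetric : RMetric (Cn n) (Hopf n a) where
  inner q := (4 / ‖pt q‖ ^ 2) • cnInner n
  symm q v w := congrArg (4 / ‖pt q‖ ^ 2 * ·) (real_inner_comm (F := Cn n) w v)
  pos q v hv := conformal_inner_pos q hv
  isVonNBounded q := isVonNBounded_of_posDef (E := Cn n) _ fun v hv ↦ conformal_inner_pos q hv
  contMDiff := by
    refine smoothForm2_iff.2 fun q ↦ ?_
    have h1 : ContDiffAt ℝ ∞ (fun z : Cn n ↦ (4 / ‖z‖ ^ 2) • cnInner n) (chartAt (Cn n) q q) :=
      contDiffAt_smul_vector (contDiffAt_conformal_factor (pt_ne_zero q)) _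
    refine (h1.contMDiffAt.comp q (contMDiffAt_chart q)).congr_of_eventuallyEq ?_
    filter_upwards [eventually_chart_source (E := Cn n) q] with p hp
    refine ContinuousLinearMap.ext fun v ↦ ContinuousLinearMap.ext fun w ↦ ?_
    exact conformal_inner_fr hp v w

theorem hopfMetric_apply (q : Hopf n a) (v w : Cn n) :
    (hopfMetric n a).inner q v w = 4 / ‖pt q‖ ^ 2 * inner ℝ v w := rfl

variable (n a) in
/-- The Lee form of the Hopf manifold, induced by `-2 dr / r`. -/
def hopfLee : Form1 (Cn n) (Hopf n a) := fun q ↦ (-(1 / 2) * (4 / ‖pt q‖ ^ 2)) • cnInner n (pt q)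

theorem hopfLee_apply (q : Hopf n a) (v : Cn n) :
    hopfLee n a q v = -(1 / 2) * (4 / ‖pt q‖ ^ 2 * inner ℝ (pt q) v) := mul_assoc _ _ _

/-- The position vector scales like a tangent vector, so it defines a vector field on the quotient,
and `θ` is `-1/2` times its metric dual. -/
theorem hopfLee_fr {q p : Hopf n a} (hp : p ∈ (chartAt (Cn n) q).source) (v : Cn n) :
    hopfLee n a p (fr q p v) =
      -(1 / 2) * (4 / ‖chartAt (Cn n) q p‖ ^ 2 * inner ℝ (chartAt (Cn n) q p) v) := by
  have h1 : pt p = fr q p (chartAt (Cn n) q p) := by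
    obtain ⟨c, -, h1, h⟩ := exists_fr_eq hp
    rw [h, h1]
  rw [← conformal_inner_fr hp, ← h1]
  exact hopfLee_apply p _

theorem smoothForm1_hopfLee : SmoothForm1 (hopfLee n a) := by
  refine smoothForm1_iff.2 fun q ↦ ?_
  have h1 : ContDiffAt ℝ ∞ (fun z : Cn n ↦ (-(1 / 2) * (4 / ‖z‖ ^ 2)) • cnInner n z)
      (chartAt (Cn n) q q) :=
    (contDiffAt_const.mul (contDiffAt_conformal_factor (pt_ne_zero q))).smul
      (cnInner n).contDiff.contDiffAt
  refine (h1.contMDiffAt.comp q (contMDiffAt_chart q)).congr_of_eventuallyEq ?_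
  filter_upwards [eventually_chart_source (E := Cn n) q] with p hp
  refine ContinuousLinearMap.ext fun v ↦ ?_
  exact (hopfLee_fr hp v).trans (mul_assoc _ _ _).symm

end HopfTensors


/-! ### The Vaisman property of the Hopf manifold -/

section HopfVaisman

variable {n : ℕ} {a : ℝ} [ha : Fact (1 < a)] {q : Hopf n a} {X Y Z : VField (Cn n) (Hopf n a)}

theorem differentiableAt_hat (hX : DiffAt X q) : DifferentiableAt ℝ (hat q X) (pt q) :=
  hX.differentiableAt_hat

theorem hat_pt (q : Hopf n a) (X : VField (Cn n) (Hopf n a)) : hat q X (pt q) = X q := hat_self q X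

theorem fr_hat {z : Cn n} (hz : z ∈ (chartAt (Cn n) q).target) (X : VField (Cn n) (Hopf n a)) :
    fr q ((chartAt (Cn n) q).symm z) (hat q X z) = X ((chartAt (Cn n) q).symm z) :=
  fr_cofr ((chartAt (Cn n) q).map_target hz) _

theorem diff_hopfMetric (hX : DiffAt X q) (hY : DiffAt Y q) (v : Cn n) :
    diff (E := Cn n) (fun p ↦ (hopfMetric n a).inner p (X p) (Y p)) q v =
      4 / ‖pt q‖ ^ 2 * (inner ℝ (fderiv ℝ (hat q X) (pt q) v) (hat q Y (pt q)) +
        inner ℝ (hat q X (pt q)) (fderiv ℝ (hat q Y) (pt q) v))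
        - 8 * inner ℝ (pt q) v / ‖pt q‖ ^ 4 * inner ℝ (hat q X (pt q)) (hat q Y (pt q)) := by
  rw [← fderiv_conformal_inner (pt_ne_zero q) (differentiableAt_hat hX) (differentiableAt_hat hY)]
  refine (diff_eq_fderiv (mdifferentiableAt_inner _ hX hY) v).trans ?_
  refine DFunLike.congr_fun (Filter.EventuallyEq.fderiv_eq ?_) v
  filter_upwards [eventually_chart_target q] with z hz
  have hp := (chartAt (Cn n) q).map_target hz
  have h := conformal_inner_fr hp (hat q X z) (hat q Y z)
  rw [(chartAt (Cn n) q).right_inv hz, fr_hat hz, fr_hat hz] at h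
  exact h

theorem diff_hopfLee (hY : DiffAt Y q) (v : Cn n) :
    diff (E := Cn n) (fun p ↦ hopfLee n a p (Y p)) q v =
      -(1 / 2) * (4 / ‖pt q‖ ^ 2 * (inner ℝ v (hat q Y (pt q)) +
        inner ℝ (pt q) (fderiv ℝ (hat q Y) (pt q) v))
        - 8 * inner ℝ (pt q) v / ‖pt q‖ ^ 4 * inner ℝ (pt q) (hat q Y (pt q))) := by
  -- `θ` is the metric pairing with the position field, whose chart expression is the identity map.
  have h0 := fderiv_conformal_inner (pt_ne_zero q) differentiableAt_id (differentiableAt_hat hY) v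
  have h1 : fderiv ℝ (id : Cn n → Cn n) (pt q) v = v := by rw [fderiv_id]; rfl
  rw [h1] at h0
  simp only [id] at h0
  rw [← h0]
  refine (diff_eq_fderiv (smoothForm1_hopfLee.mdifferentiableAt_apply hY) v).trans ?_
  have h2 : (fun z ↦ hopfLee n a ((chartAt (Cn n) q).symm z) (Y ((chartAt (Cn n) q).symm z)))
      =ᶠ[𝓝 (pt q)] fun z ↦ -(1 / 2) * (4 / ‖z‖ ^ 2 * inner ℝ z (hat q Y z)) := by
    filter_upwards [eventually_chart_target q] with z hz
    have hp := (chartAt (Cn n) q).map_target hz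
    have h := hopfLee_fr hp (hat q Y z)
    rw [(chartAt (Cn n) q).right_inv hz, fr_hat hz] at h
    exact h
  refine (DFunLike.congr_fun h2.fderiv_eq v).trans ?_
  have h3 : DifferentiableAt ℝ (fun z : Cn n ↦ 4 / ‖z‖ ^ 2 * inner ℝ z (hat q Y z)) (pt q) :=
    ((contDiffAt_conformal_factor (pt_ne_zero q)).differentiableAt (by simp)).mul
      (differentiableAt_id.inner ℝ (differentiableAt_hat hY))
  rw [fderiv_const_mul h3]
  rfl

theorem isHermitian_hopf : IsHermitian (hopfJ n a) (hopfMetric n a) := fun q v w ↦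
  congrArg (4 / ‖pt q‖ ^ 2 * ·) (inner_mulI_mulI v w)

/-- In a chart the derivative of the coefficients of `θ` is symmetric, `θ` being `-2 d log |z|`; the
derivatives of `X` and `Y` cancel against the bracket. -/
theorem closed1_hopfLee : Closed1 (hopfLee n a) := by
  intro q X Y hX hY
  have h1 := diff_hopfLee hX
  have h2 := diff_hopfLee hY
  rw [extDeriv1, bracket_eq, ← hat_self q X, ← hat_self q Y]
  have key : ∀ u v : Cn n, -(1 / 2) * (4 / ‖pt q‖ ^ 2 * (inner ℝ u v +
        inner ℝ (pt q) (fderiv ℝ (hat q Y) (pt q) u))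
        - 8 * inner ℝ (pt q) u / ‖pt q‖ ^ 4 * inner ℝ (pt q) v)
      - -(1 / 2) * (4 / ‖pt q‖ ^ 2 * (inner ℝ v u +
        inner ℝ (pt q) (fderiv ℝ (hat q X) (pt q) v))
        - 8 * inner ℝ (pt q) v / ‖pt q‖ ^ 4 * inner ℝ (pt q) u)
      - -(1 / 2) * (4 / ‖pt q‖ ^ 2 * inner ℝ (pt q) (fderiv ℝ (hat q Y) (pt q) u -
        fderiv ℝ (hat q X) (pt q) v)) = 0 := by
    intro u v
    rw [inner_sub_right, real_inner_comm v u]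
    ring
  refine Eq.trans ?_ (key (hat q X (pt q)) (hat q Y (pt q)))
  exact congrArg₂ _ (congrArg₂ _ (h2 _) (h1 _)) (hopfLee_apply q _)

theorem diff_fundamentalForm_hopf (hX : DiffAt X q) (hY : DiffAt Y q) (v : Cn n) :
    diff (E := Cn n) (fun p ↦ fundamentalForm (hopfJ n a) (hopfMetric n a) p (X p) (Y p)) q v =
      4 / ‖pt q‖ ^ 2 * (inner ℝ (mulI n (fderiv ℝ (hat q X) (pt q) v)) (hat q Y (pt q)) +
        inner ℝ (mulI n (hat q X (pt q))) (fderiv ℝ (hat q Y) (pt q) v))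
        - 8 * inner ℝ (pt q) v / ‖pt q‖ ^ 4 *
          inner ℝ (mulI n (hat q X (pt q))) (hat q Y (pt q)) := by
  have h : hat q (fun p ↦ hopfEnd n a p (X p)) (pt q) = mulI n (hat q X (pt q)) :=
    (hat_hopfEnd q X).self_of_nhds
  rw [← fderiv_hat_hopfEnd hX, ← h]
  exact diff_hopfMetric ((hopfJ n a).diffAt hX) hY v

/-- `ω` is `4 |z|⁻²` times a form with constant coefficients, so `dω = d log(|z|⁻²) ∧ ω = θ ∧ ω`. -/
theorem lee_hopf (hX : DiffAt X q) (hY : DiffAt Y q) (hZ : DiffAt Z q) :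
    extDeriv2 (fundamentalForm (hopfJ n a) (hopfMetric n a)) X Y Z q =
      wedge12 (hopfLee n a) (fundamentalForm (hopfJ n a) (hopfMetric n a)) q (X q) (Y q) (Z q) := by
  have h1 := diff_fundamentalForm_hopf hY hZ
  have h2 := diff_fundamentalForm_hopf hX hZ
  have h3 := diff_fundamentalForm_hopf hX hY
  rw [extDeriv2, bracket_eq, bracket_eq, bracket_eq, wedge12, ← hat_self q X, ← hat_self q Y,
    ← hat_self q Z]
  have hz : ‖pt q‖ ≠ 0 := norm_ne_zero_iff.2 (pt_ne_zero q)
  have skew : ∀ v w : Cn n, inner ℝ (mulI n v) w = -inner ℝ (mulI n w) v := fun v w ↦ by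
    rw [inner_mulI_left, real_inner_comm]
  set A : Cn n →L[ℝ] Cn n := fderiv ℝ (hat q X) (pt q)
  set B : Cn n →L[ℝ] Cn n := fderiv ℝ (hat q Y) (pt q)
  set C : Cn n →L[ℝ] Cn n := fderiv ℝ (hat q Z) (pt q)
  have key : ∀ u v w : Cn n,
      4 / ‖pt q‖ ^ 2 * (inner ℝ (mulI n (B u)) w + inner ℝ (mulI n v) (C u))
        - 8 * inner ℝ (pt q) u / ‖pt q‖ ^ 4 * inner ℝ (mulI n v) w
      - (4 / ‖pt q‖ ^ 2 * (inner ℝ (mulI n (A v)) w + inner ℝ (mulI n u) (C v))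
        - 8 * inner ℝ (pt q) v / ‖pt q‖ ^ 4 * inner ℝ (mulI n u) w)
      + (4 / ‖pt q‖ ^ 2 * (inner ℝ (mulI n (A w)) v + inner ℝ (mulI n u) (B w))
        - 8 * inner ℝ (pt q) w / ‖pt q‖ ^ 4 * inner ℝ (mulI n u) v)
      - 4 / ‖pt q‖ ^ 2 * inner ℝ (mulI n (B u - A v)) w
      + 4 / ‖pt q‖ ^ 2 * inner ℝ (mulI n (C u - A w)) v
      - 4 / ‖pt q‖ ^ 2 * inner ℝ (mulI n (C v - B w)) u
      = -(1 / 2) * (4 / ‖pt q‖ ^ 2 * inner ℝ (pt q) u) * (4 / ‖pt q‖ ^ 2 * inner ℝ (mulI n v) w)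
      - -(1 / 2) * (4 / ‖pt q‖ ^ 2 * inner ℝ (pt q) v) * (4 / ‖pt q‖ ^ 2 * inner ℝ (mulI n u) w)
      + -(1 / 2) * (4 / ‖pt q‖ ^ 2 * inner ℝ (pt q) w) *
        (4 / ‖pt q‖ ^ 2 * inner ℝ (mulI n u) v) := by
    intro u v w
    rw [skew v (C u), skew u (C v), skew u (B w)]
    simp only [map_sub, inner_sub_left]
    field_simp
    ring
  refine Eq.trans ?_ ((key (hat q X (pt q)) (hat q Y (pt q)) (hat q Z (pt q))).trans ?_)
  · exact congrArg₂ _ (congrArg₂ _ (congrArg₂ _ (congrArg₂ _ (congrArg₂ _ (h1 _) (h2 _)) (h3 _))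
      rfl) rfl) rfl
  · exact (congrArg₂ _ (congrArg₂ _ (congrArg (· * _) (hopfLee_apply q _))
      (congrArg (· * _) (hopfLee_apply q _))) (congrArg (· * _) (hopfLee_apply q _))).symm

theorem isLCKWith_hopf : IsLCKWith (hopfJ n a) (hopfMetric n a) (hopfLee n a) where
  hermitian := isHermitian_hopf
  smooth := smoothForm1_hopfLee
  closed := closed1_hopfLee
  lee _ _ _ _ hX hY hZ := lee_hopf hX hY hZ

/-- The Christoffel symbols of `4 |z|⁻² g_{ℂⁿ}`. -/
def christoffel (z w : Cn n) : Cn n →L[ℝ] Cn n :=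
  -(‖z‖ ^ 2)⁻¹ • ((cnInner n z).smulRight w + cnInner n z w • ContinuousLinearMap.id ℝ (Cn n)
    - (cnInner n w).smulRight z)

/-- For a conformal metric `e^{2φ} ⟨·, ·⟩` the symbols are `dφ(v) w + dφ(w) v - ⟨v, w⟩ ∇φ`; here `φ
= log 2 - log |z|`, so `∇φ = -|z|⁻² z`. -/
theorem christoffel_apply (z w v : Cn n) : christoffel z w v =
    -(‖z‖ ^ 2)⁻¹ • (inner ℝ z v • w + inner ℝ z w • v - inner ℝ w v • z) := rfl

theorem christoffel_add (z w w' : Cn n) :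
    christoffel z (w + w') = christoffel z w + christoffel z w' := by
  refine ContinuousLinearMap.ext fun v ↦ ?_
  rw [add_apply, christoffel_apply, christoffel_apply, christoffel_apply, inner_add_right,
    inner_add_left]
  module

theorem christoffel_smul (z w : Cn n) (c : ℝ) :
    christoffel z (c • w) = c • christoffel z w := by
  refine ContinuousLinearMap.ext fun v ↦ ?_
  rw [smul_apply, christoffel_apply, christoffel_apply, real_inner_smul_right,
    real_inner_smul_left]
  module

/-- The Levi-Civita connection of the Hopf manifold, as a map into `ℂⁿ`. -/
def hopfCov (Y : VField (Cn n) (Hopf n a)) (q : Hopf n a) : Cn n →L[ℝ] Cn n :=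
  fderiv ℝ (hat q Y) (pt q) + christoffel (pt q) (hat q Y (pt q))

theorem hat_add (q : Hopf n a) (X Y : VField (Cn n) (Hopf n a)) :
    hat q (X + Y) = hat q X + hat q Y := by
  funext z
  exact map_add (cofr q ((chartAt (Cn n) q).symm z)) _ _

theorem hat_smul (q : Hopf n a) (f : Hopf n a → ℝ) (X : VField (Cn n) (Hopf n a)) :
    hat q (f • X) = fun z ↦ f ((chartAt (Cn n) q).symm z) • hat q X z := by
  funext z
  exact map_smul (cofr q ((chartAt (Cn n) q).symm z)) _ _

theorem hopfCov_add (hX : DiffAt X q) (hY : DiffAt Y q) :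
    hopfCov (X + Y) q = hopfCov X q + hopfCov Y q := by
  rw [hopfCov, hat_add, fderiv_add (differentiableAt_hat hX) (differentiableAt_hat hY),
    Pi.add_apply, christoffel_add, hopfCov, hopfCov]
  abel

theorem hopfCov_smul (hX : DiffAt X q) {f : Hopf n a → ℝ}
    (hf : MDifferentiableAt 𝓘(ℝ, Cn n) 𝓘(ℝ, ℝ) f q) (v : Cn n) :
    hopfCov (f • X) q v = f q • hopfCov X q v + diff (E := Cn n) f q v • hat q X (pt q) := by
  have h1 : DifferentiableAt ℝ (fun z ↦ f ((chartAt (Cn n) q).symm z)) (pt q) :=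
    differentiableAt_comp_chart_symm hf
  have h2 : (chartAt (Cn n) q).symm (pt q) = q :=
    (chartAt (Cn n) q).left_inv (mem_chart_source _ q)
  rw [hopfCov, hat_smul, fderiv_fun_smul h1 (differentiableAt_hat hX), h2, christoffel_smul,
    hopfCov, diff_eq_fderiv hf]
  simp only [add_apply, smul_apply, ContinuousLinearMap.smulRight_apply, smul_add, h2]
  rw [pt]
  abel

variable (n a) in
/-- The Levi-Civita connection of the Hopf manifold. -/
def hopfConnection :
    CovariantDerivative 𝓘(ℝ, Cn n) (Cn n) (fun x : Hopf n a ↦ TangentSpace 𝓘(ℝ, Cn n) x) where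
  toFun := hopfCov
  isCovariantDerivativeOnUniv :=
    { add := fun hX hY _ ↦ hopfCov_add hX hY
      leibniz := fun {X f q} hX hf _ ↦ by
        refine ContinuousLinearMap.ext fun v ↦ ?_
        refine (hopfCov_smul hX hf v).trans ?_
        rw [hat_pt]
        rfl }

theorem isLeviCivita_hopfConnection : IsLeviCivita (hopfMetric n a) (hopfConnection n a) where
  torsion_free q X Y hX hY := by
    rw [bracket_eq]
    have key : ∀ u v : Cn n, fderiv ℝ (hat q Y) (pt q) u + christoffel (pt q) v u
        - (fderiv ℝ (hat q X) (pt q) v + christoffel (pt q) u v) =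
        fderiv ℝ (hat q Y) (pt q) u - fderiv ℝ (hat q X) (pt q) v := by
      intro u v
      rw [christoffel_apply, christoffel_apply, real_inner_comm u v]
      module
    have h := key (hat q X (pt q)) (hat q Y (pt q))
    rw [← hat_self q X, ← hat_self q Y]
    exact h
  metric q v Y Z hY hZ := by
    refine (diff_hopfMetric hY hZ v).trans ?_
    have hz : ‖pt q‖ ≠ 0 := norm_ne_zero_iff.2 (pt_ne_zero q)
    have key : ∀ v y y' w w' : Cn n, 4 / ‖pt q‖ ^ 2 * (inner ℝ y' w + inner ℝ y w')
        - 8 * inner ℝ (pt q) v / ‖pt q‖ ^ 4 * inner ℝ y w =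
        4 / ‖pt q‖ ^ 2 * inner ℝ (y' + christoffel (pt q) y v) w
          + 4 / ‖pt q‖ ^ 2 * inner ℝ y (w' + christoffel (pt q) w v) := by
      intro v y y' w w'
      rw [christoffel_apply, christoffel_apply]
      simp only [inner_add_left, inner_add_right, inner_sub_left, inner_sub_right,
        real_inner_smul_left, real_inner_smul_right]
      rw [real_inner_comm w v, real_inner_comm (pt q) y]
      field_simp
      ring
    rw [← hat_self q Y, ← hat_self q Z]
    exact key v _ _ _ _

/-- Geometrically, `4 r⁻² g` is the product metric `(2 dr / r)² + 4 g_S` with `g_S` the metric of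
the unit sphere, and `θ = -d(2 log r)` is parallel as the differential of the line coordinate. The
verification uses the Christoffel symbols. -/
theorem isVaismanWith_hopf : IsVaismanWith (hopfJ n a) (hopfMetric n a) (hopfLee n a) := by
  refine ⟨isLCKWith_hopf, hopfConnection n a, isLeviCivita_hopfConnection, fun q v Y hY ↦ ?_⟩
  rw [sub_eq_zero]
  refine (diff_hopfLee hY v).trans (Eq.trans ?_ (hopfLee_apply q (hopfCov Y q v)).symm)
  have hz : ‖pt q‖ ≠ 0 := norm_ne_zero_iff.2 (pt_ne_zero q)
  have key : ∀ v y y' : Cn n, -(1 / 2) * (4 / ‖pt q‖ ^ 2 * (inner ℝ v y + inner ℝ (pt q) y')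
        - 8 * inner ℝ (pt q) v / ‖pt q‖ ^ 4 * inner ℝ (pt q) y) =
      -(1 / 2) * (4 / ‖pt q‖ ^ 2 * inner ℝ (pt q) (y' + christoffel (pt q) y v)) := by
    intro v y y'
    rw [christoffel_apply]
    simp only [inner_add_right, inner_sub_right, real_inner_smul_right, real_inner_self_eq_norm_sq]
    rw [real_inner_comm y v]
    field_simp
    ring
  exact key v _ _

theorem sharp_hopfLee (q : Hopf n a) :
    sharp (hopfMetric n a) (hopfLee n a) q = (-(1 / 2 : ℝ) • pt q : Cn n) := by
  refine (sharp_eq_iff _ _).2 fun w ↦ ?_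
  refine Eq.trans ?_ (hopfLee_apply q w).symm
  refine (hopfMetric_apply q _ w).trans ?_
  refine (congrArg _ (real_inner_smul_left (F := Cn n) _ _ _)).trans ?_
  ring

theorem fnorm_hopfLee (q : Hopf n a) : fnorm (hopfMetric n a) (hopfLee n a) q = 1 := by
  rw [fnorm, vnorm, sharp_hopfLee]
  have hz : ‖pt q‖ ≠ 0 := norm_ne_zero_iff.2 (pt_ne_zero q)
  have h : 4 / ‖pt q‖ ^ 2 * inner ℝ (-(1 / 2 : ℝ) • pt q) (-(1 / 2 : ℝ) • pt q) = 1 := by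
    rw [real_inner_smul_left, real_inner_smul_right, real_inner_self_eq_norm_sq]
    field_simp
    norm_num
  exact (congrArg Real.sqrt h).trans Real.sqrt_one

end HopfVaisman


/-! ### Tensors, functions and maps through the projection -/

section HopfProjection

variable {n : ℕ} {a : ℝ} [ha : Fact (1 < a)]

theorem mfderiv_hopfProj (x : punctured n) : ∃ c : ℝ, 0 < c ∧ pt (hopfProj a x) = c • (x : Cn n) ∧
    ∀ v : Cn n, mfderiv 𝓘(ℝ, Cn n) 𝓘(ℝ, Cn n) (hopfProj a) x v = (c • v : Cn n) := by
  obtain ⟨c, hc, h1, h2⟩ := hasMFDerivAt_hopfProj (a := a) x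
  refine ⟨c, hc, h1, fun v ↦ ?_⟩
  rw [h2.mfderiv]
  rfl

theorem hopfJ_mfderiv (x : punctured n) (v : Cn n) :
    hopfJ n a (hopfProj a x) (mfderiv 𝓘(ℝ, Cn n) 𝓘(ℝ, Cn n) (hopfProj a) x v) =
      mfderiv 𝓘(ℝ, Cn n) 𝓘(ℝ, Cn n) (hopfProj a) x (Complex.I • v : Cn n) := by
  obtain ⟨c, -, -, h⟩ := mfderiv_hopfProj (a := a) x
  rw [h, h]
  exact map_smul (mulI n) c v

theorem hopfMetric_mfderiv (x : punctured n) (v w : Cn n) :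
    (hopfMetric n a).inner (hopfProj a x) (mfderiv 𝓘(ℝ, Cn n) 𝓘(ℝ, Cn n) (hopfProj a) x v)
      (mfderiv 𝓘(ℝ, Cn n) 𝓘(ℝ, Cn n) (hopfProj a) x w) =
        4 / ‖(x : Cn n)‖ ^ 2 * inner ℝ v w := by
  obtain ⟨c, hc, hx, h⟩ := mfderiv_hopfProj (a := a) x
  rw [h, h]
  refine (hopfMetric_apply _ _ _).trans ?_
  have h0 : ‖(x : Cn n)‖ ≠ 0 := norm_ne_zero_iff.2 (punctured_ne_zero x)
  rw [hx, norm_smul, real_inner_smul_left, real_inner_smul_right, Real.norm_of_nonneg hc.le]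
  field_simp

theorem contMDiff_norm_punctured :
    ContMDiff 𝓘(ℝ, Cn n) 𝓘(ℝ, ℝ) ∞ (fun y : punctured n ↦ ‖(y : Cn n)‖) := fun y ↦
  ((contDiffAt_norm ℝ (punctured_ne_zero y)).contMDiffAt (n := ∞)).comp y
    contMDiff_subtype_val.contMDiffAt

theorem hasFDerivAt_norm_cn {z : Cn n} (hz : z ≠ 0) :
    HasFDerivAt (fun z : Cn n ↦ ‖z‖) (‖z‖⁻¹ • cnInner n z) z := by
  have h0 : ‖z‖ ≠ 0 := norm_ne_zero_iff.2 hz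
  have h2 : HasFDerivAt (fun z : Cn n ↦ √(‖z‖ ^ 2)) ((1 / (2 * √(‖z‖ ^ 2))) •
      (2 • innerSL ℝ z)) z :=
    (hasStrictFDerivAt_norm_sq z).hasFDerivAt.sqrt (pow_ne_zero 2 h0)
  simp only [Real.sqrt_sq (norm_nonneg _)] at h2
  refine h2.congr_fderiv (ContinuousLinearMap.ext fun v ↦ ?_)
  simp only [smul_apply, innerSL_apply_apply, nsmul_eq_mul, smul_eq_mul, cnInner_apply]
  push_cast
  field_simp

theorem diff_norm_punctured (x : punctured n) (v : Cn n) :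
    diff (E := Cn n) (fun y : punctured n ↦ ‖(y : Cn n)‖) x v =
      inner ℝ (x : Cn n) v / ‖(x : Cn n)‖ := by
  refine (diff_eq_fderiv ((contMDiff_norm_punctured x).mdifferentiableAt (by simp)) v).trans ?_
  have h1 : (fun z : Cn n ↦ ‖((chartAt (Cn n) x).symm z : Cn n)‖) =ᶠ[𝓝 (x : Cn n)]
      fun z ↦ ‖z‖ := by
    filter_upwards [eventually_chart_target (E := Cn n) x] with z hz
    exact congrArg norm ((chartAt (Cn n) x).right_inv hz)
  refine (DFunLike.congr_fun h1.fderiv_eq v).trans ?_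
  rw [(hasFDerivAt_norm_cn (punctured_ne_zero x)).fderiv]
  exact (div_eq_inv_mul _ _).symm

theorem hopfLee_mfderiv (x : punctured n) (v : Cn n) :
    hopfLee n a (hopfProj a x) (mfderiv 𝓘(ℝ, Cn n) 𝓘(ℝ, Cn n) (hopfProj a) x v) =
      -2 * diff (E := Cn n) (fun y : punctured n ↦ ‖(y : Cn n)‖) x v / ‖(x : Cn n)‖ := by
  obtain ⟨c, hc, hx, h⟩ := mfderiv_hopfProj (a := a) x
  rw [h, diff_norm_punctured]
  refine (hopfLee_apply _ _).trans ?_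
  have h0 : ‖(x : Cn n)‖ ≠ 0 := norm_ne_zero_iff.2 (punctured_ne_zero x)
  rw [hx, norm_smul, real_inner_smul_left, real_inner_smul_right, Real.norm_of_nonneg hc.le]
  field_simp
  ring

theorem eq_comp_chart {α : Type*} {f : Hopf n a → α} {ψ : Cn n → α}
    (hf : ∀ x : punctured n, f (hopfProj a x) = ψ x) {q p : Hopf n a}
    (hp : p ∈ (chartAt (Cn n) q).source) : f p = ψ (chartAt (Cn n) q p) := by
  have h := chart_symm_eq ((chartAt (Cn n) q).map_source hp)
  rw [(chartAt (Cn n) q).left_inv hp] at h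
  nth_rw 1 [h]
  rw [hf]

section Smooth

variable {F : Type*} [NormedAddCommGroup F] [NormedSpace ℝ F] {H : Type*} [TopologicalSpace H]
  {I : ModelWithCorners ℝ F H} {N : Type*} [TopologicalSpace N] [ChartedSpace H N]

/-- A map on the Hopf manifold is smooth if it is induced by a smooth map on `ℂⁿ \ {0}`. -/
theorem contMDiff_of_hopfProj {f : Hopf n a → N} {ψ : Cn n → N}
    (hf : ∀ x : punctured n, f (hopfProj a x) = ψ x)
    (hψ : ∀ z ≠ 0, ContMDiffAt 𝓘(ℝ, Cn n) I ∞ ψ z) : ContMDiff 𝓘(ℝ, Cn n) I ∞ f := by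
  intro q
  refine (ContMDiffAt.comp (f := chartAt (Cn n) q) q (hψ _ (pt_ne_zero q))
    (contMDiffAt_chart q)).congr_of_eventuallyEq ?_
  filter_upwards [eventually_chart_source (E := Cn n) q] with p hp
  exact eq_comp_chart hf hp

/-- Near `f y` the projection is a dilation followed by the inverse of a chart. -/
theorem contMDiffAt_hopfProj_comp {f : N → punctured n} {y : N}
    (hf : ContMDiffAt I 𝓘(ℝ, Cn n) ∞ (fun t ↦ (f t : Cn n)) y) :
    ContMDiffAt I 𝓘(ℝ, Cn n) ∞ (fun t ↦ hopfProj a (f t)) y := by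
  set q := hopfProj a (f y)
  obtain ⟨c, -, -, hev⟩ := exists_chart_proj_eq (x := f y) (mem_chart_source (Cn n) q)
  have hc : ContinuousAt f y := Topology.IsInducing.subtypeVal.continuousAt_iff.2 hf.continuousAt
  have h1 : ContMDiffAt I 𝓘(ℝ, Cn n) ∞ (fun t ↦ c • (f t : Cn n)) y := 
    (contDiff_const_smul c).contMDiff.contMDiffAt.comp y hf
  have h2 : ContMDiffAt 𝓘(ℝ, Cn n) 𝓘(ℝ, Cn n) ∞ (chartAt (Cn n) q).symm (c • (f y : Cn n)) := by
    refine (contMDiffOn_chart_symm (x := q)).contMDiffAt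
      ((chartAt (Cn n) q).open_target.mem_nhds ?_)
    rw [← hev.self_of_nhds.2]
    exact mem_chart_target (Cn n) q
  refine (h2.comp y h1).congr_of_eventuallyEq ?_
  filter_upwards [hc.eventually hev] with t ht
  rw [Function.comp_apply, ← ht.2, (chartAt (Cn n) q).left_inv ht.1]

end Smooth

theorem comp_norm_zpow {h : ℝ → ℝ} (hh : ∀ r, 0 < r → h (a * r) = h r) (k : ℤ) :
    ∀ r, 0 < r → h (a ^ k * r) = h r := by
  have h0 : (0 : ℝ) < a := zero_lt_one.trans ha.out
  induction k using Int.induction_on with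
  | zero => simp
  | succ k ih =>
    intro r hr
    rw [zpow_add_one₀ h0.ne', mul_assoc, ih _ (mul_pos h0 hr), hh r hr]
  | pred k ih =>
    intro r hr
    rw [zpow_sub_one₀ h0.ne', mul_assoc, ih _ (mul_pos (inv_pos.2 h0) hr),
      ← hh _ (mul_pos (inv_pos.2 h0) hr), mul_inv_cancel_left₀ h0.ne']

theorem exists_hopfProj_lift {α : Type*} {φ : punctured n → α}
    (hφ : ∀ (k : Dilations a) x, φ (k • x) = φ x) :
    ∃ f : Hopf n a → α, ∀ x, f (hopfProj a x) = φ x :=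
  ⟨Quotient.lift φ (by rintro _ y ⟨k, rfl⟩; exact hφ k y), fun _ ↦ rfl⟩

theorem norm_dilation_smul (k : Dilations a) (x : punctured n) :
    ‖((k • x : punctured n) : Cn n)‖ = a ^ k.exponent * ‖(x : Cn n)‖ := by
  rw [coe_dilation_smul, norm_smul, Real.norm_of_nonneg (dilation_pos _).le]

theorem exists_radial {h : ℝ → ℝ} (hh : IsRadialProfile a h) :
    ∃ f : Hopf n a → ℝ, ∀ x : punctured n, f (hopfProj a x) = h ‖(x : Cn n)‖ := by
  refine exists_hopfProj_lift fun k x ↦ ?_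
  rw [norm_dilation_smul]
  exact comp_norm_zpow hh.periodic _ _ (norm_pos_iff.2 (punctured_ne_zero x))

/-- In the chart at `q` both `df` and `θ` are multiples of `⟨z, ·⟩`, whence `df ∧ θ = 0`. -/
theorem isAdmissible_radial (hn : 2 ≤ n) {h : ℝ → ℝ} (hh : IsRadialProfile a h)
    {f : Hopf n a → ℝ} (hf : ∀ x : punctured n, f (hopfProj a x) = h ‖(x : Cn n)‖) :
    IsAdmissible (hopfLee n a) f := by
  have hsm : ∀ z : Cn n, z ≠ 0 → ContDiffAt ℝ ∞ (fun z ↦ h ‖z‖) z := fun z hz ↦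
    (hh.smooth.contDiffAt (Ioi_mem_nhds (norm_pos_iff.2 hz))).comp z (contDiffAt_norm ℝ hz)
  have hsmooth : ContMDiff 𝓘(ℝ, Cn n) 𝓘(ℝ, ℝ) ∞ f :=
    contMDiff_of_hopfProj (ψ := fun z ↦ h ‖z‖) hf fun z hz ↦ (hsm z hz).contMDiffAt
  refine ⟨hsmooth, ?_, fun q ↦ ?_, fun q ↦ ?_⟩
  · rintro ⟨c, hc⟩
    refine hh.nonconst ⟨c, fun r hr ↦ ?_⟩
    -- Every radius must be attained by a vector, which fails for `n = 0`.
    have : Nonempty (Fin n) := ⟨⟨0, by omega⟩⟩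
    obtain ⟨z, hz⟩ := exists_norm_eq (Cn n) hr.le
    have hz0 : z ≠ 0 := norm_ne_zero_iff.1 (hz ▸ hr.ne')
    have h1 := hf ⟨z, hz0⟩
    rw [hc] at h1
    rw [h1, hz]
  · obtain ⟨x, rfl⟩ := hopfProj_surjective q
    rw [hf]
    exact (abs_lt.1 (hh.abs_lt_one _ (norm_pos_iff.2 (punctured_ne_zero x)))).1
  · have hz : ‖pt q‖ ≠ 0 := norm_ne_zero_iff.2 (pt_ne_zero q)
    have hdf : ∀ v : Cn n, diff (E := Cn n) f q v =
        deriv h ‖pt q‖ * (‖pt q‖⁻¹ * inner ℝ (pt q) v) := by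
      intro v
      refine (diff_eq_fderiv ((hsmooth q).mdifferentiableAt (by simp)) v).trans ?_
      have h1 : (fun z ↦ f ((chartAt (Cn n) q).symm z)) =ᶠ[𝓝 (pt q)] fun z ↦ h ‖z‖ := by
        filter_upwards [eventually_chart_target q] with z hz
        rw [chart_symm_eq hz, hf]
      refine (DFunLike.congr_fun h1.fderiv_eq v).trans ?_
      have h2 : HasDerivAt h (deriv h ‖pt q‖) ‖pt q‖ :=
        ((hh.smooth.contDiffAt (Ioi_mem_nhds (norm_pos_iff.2 (pt_ne_zero q)))).differentiableAt
          (by simp)).hasDerivAt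
      have h3 := h2.comp_hasFDerivAt (pt q) (hasFDerivAt_norm_cn (pt_ne_zero q))
      exact DFunLike.congr_fun h3.fderiv v
    refine ContinuousLinearMap.ext fun v ↦ ContinuousLinearMap.ext fun w ↦ ?_
    rw [wedge_apply]
    refine (congrArg₂ _ (congrArg₂ _ (hdf v) (hopfLee_apply q w))
      (congrArg₂ _ (hopfLee_apply q v) (hdf w))).trans ?_
    change _ = (0 : ℝ)
    ring

end HopfProjection


/-! ### Polar coordinates and the diffeomorphism with `S¹ × S²ⁿ⁻¹` -/

section HopfTopology

variable {n : ℕ} {a : ℝ}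

variable (a) in
/-- The point `a ^ (t / 2π) s` of `ℂⁿ \ {0}`, for `s` in the unit sphere. -/
def polarPoint (t : ℝ) (s : Metric.sphere (0 : Cn n) 1) : punctured n :=
  ⟨Real.exp (Real.log a * t / (2 * Real.pi)) • (s : Cn n),
    smul_ne_zero (Real.exp_pos _).ne' (ne_zero_of_mem_unit_sphere s)⟩

theorem coe_polarPoint (t : ℝ) (s : Metric.sphere (0 : Cn n) 1) : (polarPoint a t s : Cn n) =
    Real.exp (Real.log a * t / (2 * Real.pi)) • (s : Cn n) := rfl

/-- The angular coordinate `2π log |z| / log a`. -/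
def radialAngle (a : ℝ) (z : Cn n) : ℝ := 2 * Real.pi * Real.log ‖z‖ / Real.log a

theorem contDiffAt_radialAngle {z : Cn n} (hz : z ≠ 0) :
    ContDiffAt ℝ ∞ (radialAngle a : Cn n → ℝ) z :=
  (contDiffAt_const.mul ((contDiffAt_norm ℝ hz).log (norm_ne_zero_iff.2 hz))).div_const _

theorem contDiffAt_arg_slitPlane {z : ℂ} (hz : z ∈ Complex.slitPlane) :
    ContDiffAt ℝ ∞ Complex.arg z := by
  refine ContDiffAt.congr_of_eventuallyEq ?_
    (.of_forall fun w ↦ (Complex.log_im w).symm : _ =ᶠ[𝓝 z] fun w ↦ Complex.imCLM (Complex.log w))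
  exact Complex.imCLM.contDiff.contDiffAt.comp z ((Complex.contDiffAt_log hz).restrict_scalars ℝ)

theorem contMDiff_coe_circle : ContMDiff (𝓡 1) 𝓘(ℝ, ℂ) ∞ (fun u : Circle ↦ (u : ℂ)) :=
  haveI : Fact (Module.finrank ℝ ℂ = 1 + 1) := ⟨Complex.finrank_real_complex⟩
  contMDiff_coe_sphere (E := ℂ) (n := 1)

/-- The angle is smooth near `u₀`, when it is measured from `u₀`. -/
theorem contMDiffAt_arg_div (u₀ : Circle) :
    ContMDiffAt (𝓡 1) 𝓘(ℝ, ℝ) ∞ (fun u : Circle ↦ Complex.arg ((u / u₀ : Circle) : ℂ)) u₀ := by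
  have h1 : ContDiffAt ℝ ∞ (fun w : ℂ ↦ Complex.arg (w / u₀)) u₀ := by
    refine ContDiffAt.comp (g := Complex.arg) (u₀ : ℂ) (contDiffAt_arg_slitPlane ?_)
      (contDiffAt_id.div_const _)
    rw [div_self (Circle.coe_ne_zero u₀)]
    exact Complex.one_mem_slitPlane
  exact h1.contMDiffAt.comp u₀ (contMDiff_coe_circle u₀)

variable [ha : Fact (1 < a)]

theorem log_pos_of_fact : 0 < Real.log a := Real.log_pos ha.out

/-- Adding `2π m` to the angle multiplies the point by `a ^ m`, which is trivial in the quotient. -/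
theorem hopfProj_polarPoint_eq {t t' : ℝ} (h : Circle.exp t = Circle.exp t')
    (s : Metric.sphere (0 : Cn n) 1) :
    hopfProj a (polarPoint a t s) = hopfProj a (polarPoint a t' s) := by
  obtain ⟨m, hm⟩ := Circle.exp_eq_exp.1 h
  refine hopfProj_eq_iff.2 ⟨(Multiplicative.ofAdd m : Multiplicative ℤ), Subtype.ext ?_⟩
  change a ^ m • (polarPoint a t' s : Cn n) = _
  rw [coe_polarPoint, coe_polarPoint, smul_smul]
  congr 1
  rw [← Real.exp_log (zpow_pos (zero_lt_one.trans ha.out) m), ← Real.exp_add, Real.log_zpow, hm]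
  congr 1
  field_simp [Real.pi_ne_zero]
  ring

theorem radialAngle_dilation_smul (k : Dilations a) (x : punctured n) :
    radialAngle a ((k • x : punctured n) : Cn n) =
      radialAngle a (x : Cn n) + k.exponent * (2 * Real.pi) := by
  have := (log_pos_of_fact (a := a)).ne'
  rw [radialAngle, radialAngle, norm_dilation_smul, Real.log_mul (dilation_pos _).ne'
    (norm_ne_zero_iff.2 (punctured_ne_zero x)), Real.log_zpow]
  field_simp
  ring

theorem radialAngle_polarPoint (t : ℝ) (s : Metric.sphere (0 : Cn n) 1) :
    radialAngle a (polarPoint a t s : Cn n) = t := by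
  have := (log_pos_of_fact (a := a)).ne'
  rw [radialAngle, coe_polarPoint, norm_smul, norm_eq_of_mem_sphere, mul_one,
    Real.norm_of_nonneg (Real.exp_pos _).le, Real.log_exp]
  field_simp

theorem exp_radialAngle {z : Cn n} (hz : z ≠ 0) :
    Real.exp (Real.log a * radialAngle a z / (2 * Real.pi)) = ‖z‖ := by
  have := (log_pos_of_fact (a := a)).ne'
  rw [radialAngle]
  have h : Real.log a * (2 * Real.pi * Real.log ‖z‖ / Real.log a) / (2 * Real.pi) =
      Real.log ‖z‖ := by
    field_simp
  rw [h, Real.exp_log (norm_pos_iff.2 hz)]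

variable (n a) in
theorem exists_hopf_angle : ∃ u : Hopf n a → Circle,
    ∀ x : punctured n, u (hopfProj a x) = Circle.exp (radialAngle a (x : Cn n)) :=
  exists_hopfProj_lift fun k x ↦ by
    rw [radialAngle_dilation_smul]
    exact Circle.exp_eq_exp.2 ⟨_, rfl⟩

variable (n a) in
theorem exists_hopf_direction : ∃ σ : Hopf n a → Cn n,
    ∀ x : punctured n, σ (hopfProj a x) = ‖(x : Cn n)‖⁻¹ • (x : Cn n) :=
  exists_hopfProj_lift fun k x ↦ by
    have h1 := (dilation_pos (a := a) k.exponent).ne'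
    have h2 := norm_ne_zero_iff.2 (punctured_ne_zero x)
    rw [norm_dilation_smul, coe_dilation_smul, smul_smul]
    congr 1
    field_simp

section Diffeo

variable [Fact (Module.finrank ℝ (Cn n) = 2 * n - 1 + 1)]

/-- `Complex.arg` jumps at `-1`. Near `u₀` it is replaced by the angle measured from `u₀` plus `arg
u₀`; the two differ by a multiple of `2π`, so the class does not change. -/
theorem contMDiff_polar : ContMDiff ((𝓡 1).prod (𝓡 (2 * n - 1))) 𝓘(ℝ, Cn n) ∞
    (fun y : Circle × Metric.sphere (0 : Cn n) 1 ↦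
      hopfProj a (polarPoint a (Complex.arg y.1) y.2)) := by
  rintro ⟨u₀, s₀⟩
  have heq : (fun y : Circle × Metric.sphere (0 : Cn n) 1 ↦
      hopfProj a (polarPoint a (Complex.arg y.1) y.2)) = fun y ↦
      hopfProj a (polarPoint a (Complex.arg ((y.1 / u₀ : Circle) : ℂ) + Complex.arg u₀) y.2) := by
    funext y
    refine hopfProj_polarPoint_eq ?_ _
    rw [Circle.exp_add, Circle.exp_arg, Circle.exp_arg, Circle.exp_arg, div_mul_cancel]
  rw [heq]
  refine contMDiffAt_hopfProj_comp ?_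
  have h1 : ContMDiffAt ((𝓡 1).prod (𝓡 (2 * n - 1))) 𝓘(ℝ, ℝ) ∞
      (fun y : Circle × Metric.sphere (0 : Cn n) 1 ↦ Complex.arg ((y.1 / u₀ : Circle) : ℂ))
      (u₀, s₀) := (contMDiffAt_arg_div u₀).comp (u₀, s₀) contMDiffAt_fst
  have h2 : ContMDiffAt ((𝓡 1).prod (𝓡 (2 * n - 1))) 𝓘(ℝ, Cn n) ∞
      (fun y : Circle × Metric.sphere (0 : Cn n) 1 ↦ (y.2 : Cn n)) (u₀, s₀) :=
    (contMDiff_coe_sphere s₀).comp (u₀, s₀) contMDiffAt_snd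
  have h3 : ContDiff ℝ ∞ (fun t : ℝ ↦
      Real.exp (Real.log a * (t + Complex.arg u₀) / (2 * Real.pi))) := by fun_prop
  exact (h3.contMDiff.contMDiffAt.comp (u₀, s₀) h1).smul h2

variable (n a) in
-- The radius modulo `a` gives the circle coordinate and the direction `x / |x|` the sphere
-- coordinate; both are dilation invariant and smooth on `ℂⁿ \ {0}`.
theorem nonempty_diffeomorph : Nonempty (Diffeomorph 𝓘(ℝ, Cn n) ((𝓡 1).prod (𝓡 (2 * n - 1)))
    (Hopf n a) (Circle × Metric.sphere (0 : Cn n) 1) ∞) := by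
  obtain ⟨u, hu⟩ := exists_hopf_angle n a
  obtain ⟨σ, hσ⟩ := exists_hopf_direction n a
  have hσ1 : ∀ q, σ q ∈ Metric.sphere (0 : Cn n) 1 := by
    intro q
    obtain ⟨x, rfl⟩ := hopfProj_surjective q
    rw [hσ, mem_sphere_zero_iff_norm, norm_smul, norm_inv, norm_norm,
      inv_mul_cancel₀ (norm_ne_zero_iff.2 (punctured_ne_zero x))]
  have hu2 : ContMDiff 𝓘(ℝ, Cn n) (𝓡 1) ∞ u :=
    contMDiff_of_hopfProj (ψ := fun z ↦ Circle.exp (radialAngle a z)) hu fun z hz ↦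
      contMDiff_circleExp.contMDiffAt.comp z (contDiffAt_radialAngle hz).contMDiffAt
  have hσ2 : ContMDiff 𝓘(ℝ, Cn n) 𝓘(ℝ, Cn n) ∞ σ :=
    contMDiff_of_hopfProj (ψ := fun z ↦ ‖z‖⁻¹ • z) hσ fun z hz ↦
      (((contDiffAt_norm ℝ hz).inv (norm_ne_zero_iff.2 hz)).smul contDiffAt_id).contMDiffAt
  exact ⟨{
    toFun := fun q ↦ (u q, Set.codRestrict σ _ hσ1 q)
    invFun := fun y ↦ hopfProj a (polarPoint a (Complex.arg y.1) y.2)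
    left_inv := fun q ↦ by
      obtain ⟨x, rfl⟩ := hopfProj_surjective q
      have h0 := punctured_ne_zero x
      -- `arg` recovers the radial angle only modulo `2π`, which suffices for the class.
      refine (hopfProj_polarPoint_eq (t' := radialAngle a (x : Cn n)) ?_ _).trans ?_
      · exact (Circle.exp_arg _).trans (hu x)
      · congr 1
        refine Subtype.ext ?_
        rw [coe_polarPoint, exp_radialAngle h0, Set.val_codRestrict_apply, hσ, smul_smul,
          mul_inv_cancel₀ (norm_ne_zero_iff.2 h0), one_smul]
    right_inv := fun y ↦ by
      refine Prod.ext ?_ (Subtype.ext ?_)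
      · change u _ = _
        rw [hu, radialAngle_polarPoint, Circle.exp_arg]
      · change σ _ = _
        rw [hσ, coe_polarPoint, norm_smul, norm_eq_of_mem_sphere, mul_one,
          Real.norm_of_nonneg (Real.exp_pos _).le, smul_smul,
          inv_mul_cancel₀ (Real.exp_pos _).ne', one_smul]
    contMDiff_toFun := hu2.prodMk (hσ2.codRestrict_sphere hσ1)
    contMDiff_invFun := contMDiff_polar }⟩

end Diffeo

theorem connectedSpace_circle : ConnectedSpace Circle :=
  Circle.exp_surjective.connectedSpace Circle.exp.continuous

theorem connectedSpace_sphere (hn : 2 ≤ n) : ConnectedSpace (Metric.sphere (0 : Cn n) 1) := by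
  refine isConnected_iff_connectedSpace.1 (isConnected_sphere ?_ _ zero_le_one)
  rw [← Module.finrank_eq_rank, finrank_Cn hn]
  exact_mod_cast (by omega : 1 < 2 * n - 1 + 1)

theorem isRadialProfile_sin : IsRadialProfile a
    (fun r ↦ 1 / 2 * Real.sin (2 * Real.pi * Real.log r / Real.log a)) where
  smooth := by
    refine contDiffOn_const.mul (Real.contDiff_sin.comp_contDiffOn ?_)
    exact (contDiffOn_const.mul (contDiffOn_id.log fun r hr ↦ (Set.mem_Ioi.1 hr).ne')).div_const _
  nonconst := by
    have hl := (log_pos_of_fact (a := a)).ne'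
    rintro ⟨c, hc⟩
    have h1 := hc 1 one_pos
    -- The profile is `0` at `r = 1` and `1/2` at `r = a ^ (1/4)`, a quarter period later.
    have h2 := hc (Real.exp (Real.log a / 4)) (Real.exp_pos _)
    have h3 : 2 * Real.pi * (Real.log a / 4) / Real.log a = Real.pi / 2 := by
      field_simp
      norm_num
    simp only [Real.log_one, mul_zero, zero_div, Real.sin_zero] at h1
    simp only [Real.log_exp, h3, Real.sin_pi_div_two] at h2
    linarith
  abs_lt_one r _ := by
    have := Real.abs_sin_le_one (2 * Real.pi * Real.log r / Real.log a)
    rw [abs_mul, abs_of_pos (by norm_num : (0 : ℝ) < 1 / 2)]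
    linarith
  periodic r hr := by
    have hl := (log_pos_of_fact (a := a)).ne'
    have h : 2 * Real.pi * Real.log (a * r) / Real.log a =
        2 * Real.pi * Real.log r / Real.log a + 2 * Real.pi := by
      rw [Real.log_mul (zero_lt_one.trans ha.out).ne' hr.ne']
      field_simp
      ring
    simp only [h, Real.sin_add_two_pi]

end HopfTopology

end

end LCK

/-! ### Assembly of the two parts -/

open LCK
theorem lemma6 :
    -- the deformation of a Vaisman metric with Lee form of norm one
    (∀ (E : Type u) [NormedAddCommGroup E] [NormedSpace ℝ E] [FiniteDimensional ℝ E]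
      (M : Type v) [TopologicalSpace M] [T2Space M] [SecondCountableTopology M]
      [ChartedSpace E M] [IsManifold 𝓘(ℝ, E) ∞ M]
      (n : ℕ) (_hn : 2 ≤ n) (_hdim : Module.finrank ℝ E = 2 * n)
      (J : ComplexStructure E M) (g : RMetric E M) (θ : Form1 E M)
      (_hV : IsVaismanWith J g θ) (_hθ : ∀ x, fnorm g θ x = 1),
      -- `df ∧ θ = 0` says that the gradient of `f` is collinear to the Lee field
      (∀ f : M → ℝ, (∀ x, wedge (diff f) θ x = 0) ↔
        ∀ x, ∃ c : ℝ, sharp g (diff f) x = c • sharp g θ x) ∧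
      ∀ f : M → ℝ, IsAdmissible θ f → ∃ gbar : RMetric E M,
        (∀ (x : M) (v w : TangentSpace 𝓘(ℝ, E) x),
          gbar.inner x v w = deformedForm J g θ f x v (J x w)) ∧
        fundamentalForm J gbar = deformedForm J g θ f ∧
        IsLCKWith J gbar (fun x ↦ (1 + f x) • θ x) ∧
        sharp gbar (fun x ↦ (1 + f x) • θ x) = sharp g θ ∧
        IsHolomorphic J (sharp g θ) ∧
        (∀ x, gbar.inner x (sharp g θ x) (sharp g θ x) = 1 + f x) ∧
        (¬ ∃ c : ℝ, ∀ x, vnorm gbar (sharp g θ) x = c) ∧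
        (ConnectedSpace M → ¬ IsVaisman J gbar)) ∧
    -- the Hopf manifold
    (∀ (n : ℕ) (a : ℝ) [Fact (1 < a)] (hn : 2 ≤ n),
      haveI : Fact (Module.finrank ℝ (Cn n) = 2 * n - 1 + 1) := ⟨finrank_Cn hn⟩
      T2Space (Hopf n a) ∧ SecondCountableTopology (Hopf n a) ∧
      CompactSpace (Hopf n a) ∧ ConnectedSpace (Hopf n a) ∧
      Nonempty (Diffeomorph 𝓘(ℝ, Cn n) ((𝓡 1).prod (𝓡 (2 * n - 1)))
        (Hopf n a) (Circle × Metric.sphere (0 : Cn n) 1) ∞) ∧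
      IsRadialProfile a (fun r ↦ 1 / 2 * Real.sin (2 * Real.pi * Real.log r / Real.log a)) ∧
      ∃ (J : ComplexStructure (Cn n) (Hopf n a)) (g : RMetric (Cn n) (Hopf n a))
        (θ : Form1 (Cn n) (Hopf n a)),
        -- `J`, `g`, `θ` are induced by `i`, `4 r⁻² g_{ℂⁿ}` and `-2 dr / r`
        (∀ (x : punctured n) (v : Cn n),
          J (hopfProj a x) (mfderiv 𝓘(ℝ, Cn n) 𝓘(ℝ, Cn n) (hopfProj a) x v) =
            mfderiv 𝓘(ℝ, Cn n) 𝓘(ℝ, Cn n) (hopfProj a) x (Complex.I • v : Cn n)) ∧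
        (∀ (x : punctured n) (v w : Cn n),
          g.inner (hopfProj a x) (mfderiv 𝓘(ℝ, Cn n) 𝓘(ℝ, Cn n) (hopfProj a) x v)
              (mfderiv 𝓘(ℝ, Cn n) 𝓘(ℝ, Cn n) (hopfProj a) x w) =
            4 / ‖(x : Cn n)‖ ^ 2 * inner ℝ v w) ∧
        (∀ (x : punctured n) (v : Cn n),
          θ (hopfProj a x) (mfderiv 𝓘(ℝ, Cn n) 𝓘(ℝ, Cn n) (hopfProj a) x v) =
            -2 * diff (E := Cn n) (fun y : punctured n ↦ ‖(y : Cn n)‖) x v / ‖(x : Cn n)‖) ∧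
        IsVaismanWith J g θ ∧ (∀ x, fnorm g θ x = 1) ∧
        ∀ h : ℝ → ℝ, IsRadialProfile a h →
          ∃ f : Hopf n a → ℝ, (∀ x : punctured n, f (hopfProj a x) = h ‖(x : Cn n)‖) ∧
            IsAdmissible θ f ∧
            ∃ gbar : RMetric (Cn n) (Hopf n a),
              (∀ (x : Hopf n a) (v w : TangentSpace 𝓘(ℝ, Cn n) x),
                gbar.inner x v w = deformedForm J g θ f x v (J x w)) ∧
              IsLCKWith J gbar (fun x ↦ (1 + f x) • θ x) ∧
              IsHolomorphic J (sharp gbar (fun x ↦ (1 + f x) • θ x)) ∧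
              ¬ IsVaisman J gbar) := by
  refine ⟨?_, ?_⟩
  · intro E _ _ _ M _ _ _ _ _ n hn hdim J g θ hV hθ
    exact ⟨fun f ↦ forall_congr' (wedge_diff_eq_zero_iff (apply_sharp_of_fnorm_eq_one hθ) f),
      fun f hf ↦ exists_deformation (by omega) hV hθ hf⟩
  · intro n a _ hn
    have : Fact (Module.finrank ℝ (Cn n) = 2 * n - 1 + 1) := ⟨finrank_Cn hn⟩
    obtain ⟨Φ⟩ := nonempty_diffeomorph n a
    have := connectedSpace_circle
    have := connectedSpace_sphere hn
    -- The topological properties are transported from the product of the circle and the sphere.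
    have : T2Space (Hopf n a) := Φ.toHomeomorph.symm.t2Space
    have : SecondCountableTopology (Hopf n a) := Φ.toHomeomorph.secondCountableTopology
    have : CompactSpace (Hopf n a) := Φ.toHomeomorph.symm.compactSpace
    have : ConnectedSpace (Hopf n a) :=
      Φ.toHomeomorph.symm.surjective.connectedSpace Φ.toHomeomorph.symm.continuous
    refine ⟨inferInstance, inferInstance, inferInstance, inferInstance, ⟨Φ⟩, isRadialProfile_sin,
      hopfJ n a, hopfMetric n a, hopfLee n a, hopfJ_mfderiv, hopfMetric_mfderiv, hopfLee_mfderiv,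
      isVaismanWith_hopf, fnorm_hopfLee, fun h hh ↦ ?_⟩
    obtain ⟨f, hf⟩ := exists_radial (n := n) hh
    have hadm := isAdmissible_radial hn hh hf
    have hdim : 3 ≤ Module.finrank ℝ (Cn n) := by
      rw [finrank_Cn hn]
      omega
    obtain ⟨gbar, h1, -, h2, h3, h4, -, -, h5⟩ :=
      exists_deformation hdim isVaismanWith_hopf fnorm_hopfLee hadm
    -- `h3` identifies the Lee field of `gbar` with that of the original metric, which is
    -- holomorphic.
    exact ⟨f, hf, hadm, gbar, h1, h2, h3 ▸ h4, h5 inferInstance⟩
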